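/- Let $\Bbbk$ be a field of characteristic zero and let $\mathcal P=\{\mathcal P(n)\}_{n\ge1}$ be a $\Bbbk$-linear shuffle operad, or a symmetric operad regarded as a shuffle operad. Suppose that $\mathcal P$ is presented as a quotient $\mathcal F(\Upsilon)/C$ of the free shuffle operad on a finite set $\Upsilon$ of generators of arity at least two (so that $\mathcal F(\Upsilon)(1)$ is spanned by the identity) and that, for some admissible ordering of the shuffle monomials, the ideal $C$ has a finite Gröbner basis whose set of leading monomials is shuffle regular. Here a set of shuffle monomials (planar rooted trees with vertices labelled by generators and leaves numbered by $1,\dots,n$ so that at every vertex the minima of the leaves above the inputs increase from left to right) is called shuffle regular if it contains, together with each monomial, all shuffle monomials with the same underlying planar vertex-labelled tree. Suppose that the sequence $\dim\mathcal P(n)$ has subfactorial growth, that is, for all $A,B>0$ there is $K>0$ such that $\dim \mathcal P(n)<K\,(n/A)^{n/B}$ for all sufficiently large $n$. (This is the case if $\dim\mathcal P(n)\le a^n$ for all $n\geq 1$ and some constant $a$.) Then: 1. the exponential generating series $E_{\mathcal P}(z)=\sum_{n\ge1}\frac{\dim\mathcal P(n)}{n!}z^n$ satisfies a nontrivial homogeneous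 linear differential equation with constant (rational) coefficients; 2. equivalently, the ordinary generating series $G_{\mathcal P}(z)=\sum_{n\ge1}\dim\mathcal P(n)\,z^n$ is the expansion of a rational function over $\mathbb Q$ (for every sequence of non-negative integers in place of $\dim\mathcal P(n)$, the properties in 1 and 2 are equivalent); 3. in particular, either $\dim \mathcal P(n)=0$ for all large $n$, or the sequence $\dim\mathcal P(n)$ has polynomial growth $n^d$ with an integer exponent $d\ge0$, or it has exponential growth $n^d b^n$ with a real number $b>1$ and an integer $d\ge0$. Here a sequence $a_n$ is said to grow as $g(n)$ if there are constants $c,C>0$ and an integer $w\geq 1$ such that, for all sufficiently large $n$, $a_n\le C g(n)$ and $a_j\ge c\,g(j)$ for at least one $j\in\{n,\dots,n+w-1\}$. -/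

import Mathlib

universe u v w

namespace ShOp

/-! ### Partial compositions, symmetric operads and shuffle operads

Operads are written in coordinate-free form, that is, as functors on finite sets of inputs; the
finite sets of natural numbers are used as sets of inputs. The component of arity `n` is the
value on `{1, …, n}`. -/

/-- `Graft A a B C`: substituting an operation with set of inputs `B` into the input `a` of an
operation with set of inputs `A` gives an operation with set of inputs `C = (A \ {a}) ⊔ B`. -/
structure Graft (A : Finset ℕ) (a : ℕ) (B C : Finset ℕ) : Prop where
  mem : a ∈ A
  disj : Disjoint (A.erase a) B
  eq : C = A.erase a ∪ B

/-- A shuffle substitution: the set `B` of inputs is inserted into the input of `A` that carries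
the label `a = min B`. -/
structure ShGraft (A : Finset ℕ) (a : ℕ) (B C : Finset ℕ) : Prop extends Graft A a B C where
  least : IsLeast (B : Set ℕ) a

/-- The relabellings `eA, eB, eC` of the inputs carry the substitution of `B` into the input `a`
of `A` to the substitution of `B'` into the input `a'` of `A'`. -/
structure GraftCompat {A A' B B' C C' : Finset ℕ} (a a' : ℕ)
    (eA : A ≃ A') (eB : B ≃ B') (eC : C ≃ C') : Prop where
  root : ∀ x : A, (x : ℕ) = a → (eA x : ℕ) = a'
  left : ∀ (x : A) (y : C), (x : ℕ) = y → (x : ℕ) ≠ a → (eC y : ℕ) = eA x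
  right : ∀ (x : B) (y : C), (x : ℕ) = y → (eC y : ℕ) = eB x

/-- A symmetric (`k`-linear) operad without operations of arity zero, with its identity, its
relabelling of inputs by arbitrary bijections, and its partial compositions `f ∘ₐ g`. -/
structure SymmetricOperad (k : Type u) [Field k] where
  obj : Finset ℕ → Type v
  [addCommGroup : ∀ A, AddCommGroup (obj A)]
  [module : ∀ A, Module k (obj A)]
  empty : Subsingleton (obj ∅)
  map : ∀ {A B : Finset ℕ}, (A ≃ B) → (obj A →ₗ[k] obj B)
  one : ∀ a : ℕ, obj {a}
  comp : ∀ {A : Finset ℕ} {a : ℕ} {B C : Finset ℕ},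
    Graft A a B C → (obj A →ₗ[k] obj B →ₗ[k] obj C)
  map_refl : ∀ {A : Finset ℕ} (f : obj A), map (Equiv.refl A) f = f
  map_trans : ∀ {A B C : Finset ℕ} (e : A ≃ B) (e' : B ≃ C) (f : obj A),
    map (e.trans e') f = map e' (map e f)
  map_one : ∀ {a b : ℕ} (e : ({a} : Finset ℕ) ≃ ({b} : Finset ℕ)), map e (one a) = one b
  map_comp : ∀ {A A' B B' C C' : Finset ℕ} {a a' : ℕ}
    (h : Graft A a B C) (h' : Graft A' a' B' C') (eA : A ≃ A') (eB : B ≃ B') (eC : C ≃ C'),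
    GraftCompat a a' eA eB eC → ∀ (f : obj A) (g : obj B),
      map eC (comp h f g) = comp h' (map eA f) (map eB g)
  one_comp : ∀ {a : ℕ} {B : Finset ℕ} (h : Graft {a} a B B) (f : obj B), comp h (one a) f = f
  comp_one : ∀ {A : Finset ℕ} {a : ℕ} (h : Graft A a {a} A) (f : obj A), comp h f (one a) = f
  assoc_seq : ∀ {A B C D E F : Finset ℕ} {a b : ℕ} (h₁ : Graft A a B C) (h₂ : Graft C b D F)
    (h₃ : Graft B b D E) (h₄ : Graft A a E F) (f : obj A) (g : obj B) (l : obj D),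
      comp h₂ (comp h₁ f g) l = comp h₄ f (comp h₃ g l)
  assoc_par : ∀ {A B C D E F : Finset ℕ} {a b : ℕ} (_ : a ≠ b) (h₁ : Graft A a B C)
    (h₂ : Graft C b D F) (h₃ : Graft A b D E) (h₄ : Graft E a B F)
    (f : obj A) (g : obj B) (l : obj D),
      comp h₂ (comp h₁ f g) l = comp h₄ (comp h₃ f l) g

attribute [instance] SymmetricOperad.addCommGroup SymmetricOperad.module

/-- A shuffle operad: only order-preserving relabellings of the inputs and only shuffle
compositions are available. -/
structure ShuffleOperad (k : Type u) [Field k] where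
  obj : Finset ℕ → Type v
  [addCommGroup : ∀ A, AddCommGroup (obj A)]
  [module : ∀ A, Module k (obj A)]
  empty : Subsingleton (obj ∅)
  map : ∀ {A B : Finset ℕ}, (A ≃o B) → (obj A →ₗ[k] obj B)
  one : ∀ a : ℕ, obj {a}
  comp : ∀ {A : Finset ℕ} {a : ℕ} {B C : Finset ℕ},
    ShGraft A a B C → (obj A →ₗ[k] obj B →ₗ[k] obj C)
  map_refl : ∀ {A : Finset ℕ} (f : obj A), map (OrderIso.refl A) f = f
  map_trans : ∀ {A B C : Finset ℕ} (e : A ≃o B) (e' : B ≃o C) (f : obj A),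
    map (e.trans e') f = map e' (map e f)
  map_one : ∀ {a b : ℕ} (e : ({a} : Finset ℕ) ≃o ({b} : Finset ℕ)), map e (one a) = one b
  map_comp : ∀ {A A' B B' C C' : Finset ℕ} {a a' : ℕ}
    (h : ShGraft A a B C) (h' : ShGraft A' a' B' C')
    (eA : A ≃o A') (eB : B ≃o B') (eC : C ≃o C'),
    GraftCompat a a' eA.toEquiv eB.toEquiv eC.toEquiv → ∀ (f : obj A) (g : obj B),
      map eC (comp h f g) = comp h' (map eA f) (map eB g)
  one_comp : ∀ {a : ℕ} {B : Finset ℕ} (h : ShGraft {a} a B B) (f : obj B), comp h (one a) f = f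
  comp_one : ∀ {A : Finset ℕ} {a : ℕ} (h : ShGraft A a {a} A) (f : obj A), comp h f (one a) = f
  assoc_seq : ∀ {A B C D E F : Finset ℕ} {a b : ℕ} (h₁ : ShGraft A a B C) (h₂ : ShGraft C b D F)
    (h₃ : ShGraft B b D E) (h₄ : ShGraft A a E F) (f : obj A) (g : obj B) (l : obj D),
      comp h₂ (comp h₁ f g) l = comp h₄ f (comp h₃ g l)
  assoc_par : ∀ {A B C D E F : Finset ℕ} {a b : ℕ} (_ : a ≠ b) (h₁ : ShGraft A a B C)
    (h₂ : ShGraft C b D F) (h₃ : ShGraft A b D E) (h₄ : ShGraft E a B F)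
    (f : obj A) (g : obj B) (l : obj D),
      comp h₂ (comp h₁ f g) l = comp h₄ (comp h₃ f l) g

attribute [instance] ShuffleOperad.addCommGroup ShuffleOperad.module

/-- The shuffle operad `Pᶠ` underlying a symmetric operad `P`. -/
def SymmetricOperad.toShuffle {k : Type u} [Field k] (P : SymmetricOperad.{u, v} k) :
    ShuffleOperad.{u, v} k where
  obj := P.obj
  empty := P.empty
  map e := P.map e.toEquiv
  one := P.one
  comp h := P.comp h.toGraft
  map_refl f := P.map_refl f
  map_trans e e' f := P.map_trans e.toEquiv e'.toEquiv f
  map_one e := P.map_one e.toEquiv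
  map_comp h h' eA eB eC hc f g :=
    P.map_comp h.toGraft h'.toGraft eA.toEquiv eB.toEquiv eC.toEquiv hc f g
  one_comp h f := P.one_comp h.toGraft f
  comp_one h f := P.comp_one h.toGraft f
  assoc_seq h₁ h₂ h₃ h₄ f g l := P.assoc_seq h₁.toGraft h₂.toGraft h₃.toGraft h₄.toGraft f g l
  assoc_par hab h₁ h₂ h₃ h₄ f g l :=
    P.assoc_par hab h₁.toGraft h₂.toGraft h₃.toGraft h₄.toGraft f g l

/-- `dim P(n)` for a shuffle operad. -/
noncomputable def ShuffleOperad.dim {k : Type u} [Field k] (P : ShuffleOperad.{u, v} k)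
    (n : ℕ) : ℕ :=
  Module.finrank k (P.obj (Finset.Icc 1 n))

/-- `dim P(n)` for a symmetric operad. -/
noncomputable def SymmetricOperad.dim {k : Type u} [Field k] (P : SymmetricOperad.{u, v} k)
    (n : ℕ) : ℕ :=
  Module.finrank k (P.obj (Finset.Icc 1 n))

/-- Morphisms of shuffle operads. -/
structure ShuffleOperad.Hom {k : Type u} [Field k]
    (P : ShuffleOperad.{u, w} k) (Q : ShuffleOperad.{u, v} k) where
  app : ∀ A : Finset ℕ, P.obj A →ₗ[k] Q.obj A
  app_map : ∀ {A B : Finset ℕ} (e : A ≃o B) (f : P.obj A), app B (P.map e f) = Q.map e (app A f)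
  app_one : ∀ a : ℕ, app {a} (P.one a) = Q.one a
  app_comp : ∀ {A : Finset ℕ} {a : ℕ} {B C : Finset ℕ} (h : ShGraft A a B C)
    (f : P.obj A) (g : P.obj B), app C (P.comp h f g) = Q.comp h (app A f) (app B g)

/-- (Two-sided) ideals of a shuffle operad. -/
structure ShuffleOperad.OpIdeal {k : Type u} [Field k] (P : ShuffleOperad.{u, v} k) where
  carrier : ∀ A : Finset ℕ, Submodule k (P.obj A)
  map_mem : ∀ {A B : Finset ℕ} (e : A ≃o B) {f : P.obj A}, f ∈ carrier A → P.map e f ∈ carrier B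
  comp_mem_left : ∀ {A : Finset ℕ} {a : ℕ} {B C : Finset ℕ} (h : ShGraft A a B C)
    {f : P.obj A} (g : P.obj B), f ∈ carrier A → P.comp h f g ∈ carrier C
  comp_mem_right : ∀ {A : Finset ℕ} {a : ℕ} {B C : Finset ℕ} (h : ShGraft A a B C)
    (f : P.obj A) {g : P.obj B}, g ∈ carrier B → P.comp h f g ∈ carrier C

/-- The ideal generated by a set `S` of elements of `⋃ₙ P(n)`, as a family of subspaces. -/
def ShuffleOperad.idealSpan {k : Type u} [Field k] (P : ShuffleOperad.{u, v} k)
    (S : ∀ n : ℕ, Set (P.obj (Finset.Icc 1 n))) (A : Finset ℕ) : Submodule k (P.obj A) :=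
  ⨅ (I : P.OpIdeal) (_ : ∀ n, S n ⊆ I.carrier (Finset.Icc 1 n)), I.carrier A

/-! ### Shuffle monomials and the free shuffle operad -/

/-- A finite set of generators; all of them have arity at least two, so that the component of
arity one of the free operad is spanned by the identity. -/
structure Generators where
  op : Type
  ar : op → ℕ
  finite : Finite op
  two_le : ∀ μ, 2 ≤ ar μ

/-- Planar rooted trees with vertices labelled by generators and leaves labelled by `L`. -/
inductive PTree (Υ : Generators) (L : Type) : Type
  | leaf : L → PTree Υ L
  | node : (μ : Υ.op) → (Fin (Υ.ar μ) → PTree Υ L) → PTree Υ L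

namespace PTree

variable {Υ : Generators}

/-- Changing the labels of the leaves. -/
def relabel {L L' : Type} (φ : L → L') : PTree Υ L → PTree Υ L'
  | leaf x => leaf (φ x)
  | node μ c => node μ fun i => (c i).relabel φ

/-- The planar (shuffle) skeleton: the labels of the leaves are erased. -/
def skeleton {L : Type} (t : PTree Υ L) : PTree Υ Unit := t.relabel fun _ => ()

/-- The set of labels of the leaves. -/
def leaves : PTree Υ ℕ → Finset ℕ
  | leaf x => {x}
  | node _ c => Finset.univ.biUnion fun i => (c i).leaves

/-- The leaves carry distinct labels, and the inputs of each vertex are ordered by the minima of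
the leaves above them: the tree is the canonical planar realization of a shuffle monomial. -/
def IsShuffle : PTree Υ ℕ → Prop
  | leaf _ => True
  | node _ c => (∀ i, (c i).IsShuffle) ∧
      ∀ i j, i < j → Disjoint (c i).leaves (c j).leaves ∧ (c i).leaves.min < (c j).leaves.min

/-- Replacing the leaf `a` by the tree `s`. -/
def graft : PTree Υ ℕ → ℕ → PTree Υ ℕ → PTree Υ ℕ
  | leaf x, a, s => if x = a then s else leaf x
  | node μ c, a, s => node μ fun i => (c i).graft a s

theorem mem_leaves_node {μ : Υ.op} {c : Fin (Υ.ar μ) → PTree Υ ℕ} {x : ℕ} :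
    x ∈ (node μ c).leaves ↔ ∃ i, x ∈ (c i).leaves := by
  simp [leaves]

theorem leaves_nonempty (t : PTree Υ ℕ) : t.leaves.Nonempty := by
  induction t with
  | leaf x => exact ⟨x, by simp [leaves]⟩
  | node μ c ih =>
    obtain ⟨x, hx⟩ := ih ⟨0, by have := Υ.two_le μ; omega⟩
    exact ⟨x, mem_leaves_node.2 ⟨_, hx⟩⟩

theorem graft_of_notMem {a : ℕ} {s t : PTree Υ ℕ} (h : a ∉ t.leaves) : t.graft a s = t := by
  induction t with
  | leaf x =>
    have : x ≠ a := by rintro rfl; simp [leaves] at h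
    simp [graft, this]
  | node μ c ih =>
    simp only [graft]
    congr 1
    funext i
    exact ih i fun hi => h (mem_leaves_node.2 ⟨i, hi⟩)

theorem mem_leaves_graft {a : ℕ} {s t : PTree Υ ℕ} {x : ℕ} :
    x ∈ (t.graft a s).leaves ↔ (x ∈ t.leaves ∧ x ≠ a) ∨ (a ∈ t.leaves ∧ x ∈ s.leaves) := by
  induction t with
  | leaf y =>
    by_cases hy : y = a
    · subst hy; simp [graft, leaves]
    · have hy' : a ≠ y := fun e => hy e.symm
      simp only [graft, hy, if_false, leaves, Finset.mem_singleton, hy', false_and, or_false]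
      grind
  | node μ c ih =>
    simp only [graft, mem_leaves_node, ih]
    grind

theorem leaves_graft {A : Finset ℕ} {a : ℕ} {B C : Finset ℕ} (h : Graft A a B C)
    {t s : PTree Υ ℕ} (ht : t.leaves = A) (hs : s.leaves = B) : (t.graft a s).leaves = C := by
  ext x
  have := h.mem
  rw [mem_leaves_graft, h.eq, ht, hs]
  simp only [Finset.mem_union, Finset.mem_erase]
  tauto

theorem min_graft {a : ℕ} {s t : PTree Υ ℕ} (hs : IsLeast (s.leaves : Set ℕ) a) :
    (t.graft a s).leaves.min = t.leaves.min := by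
  by_cases ha : a ∈ t.leaves
  · apply le_antisymm
    · refine Finset.le_min fun x hx => ?_
      by_cases hxa : x = a
      · subst hxa
        exact Finset.min_le (mem_leaves_graft.2 (Or.inr ⟨ha, hs.1⟩))
      · exact Finset.min_le (mem_leaves_graft.2 (Or.inl ⟨hx, hxa⟩))
    · refine Finset.le_min fun x hx => ?_
      rcases mem_leaves_graft.1 hx with ⟨h, -⟩ | ⟨-, h⟩
      · exact Finset.min_le h
      · exact (Finset.min_le ha).trans (WithTop.coe_le_coe.2 (hs.2 h))
  · rw [graft_of_notMem ha]

theorem isShuffle_graft {a : ℕ} {s t : PTree Υ ℕ} (ht : t.IsShuffle) (hs : s.IsShuffle)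
    (hd : Disjoint (t.leaves.erase a) s.leaves) (hl : IsLeast (s.leaves : Set ℕ) a) :
    (t.graft a s).IsShuffle := by
  induction t with
  | leaf x =>
    by_cases hx : x = a
    · simpa [graft, hx] using hs
    · simp [graft, hx, IsShuffle]
  | node μ c ih =>
    have key : ∀ x i, x ∈ (c i).leaves → x ≠ a → x ∉ s.leaves := fun x i hx hxa hxs =>
      Finset.disjoint_left.1 hd (Finset.mem_erase.2 ⟨hxa, mem_leaves_node.2 ⟨i, hx⟩⟩) hxs
    refine ⟨fun i => ih i (ht.1 i) ?_, fun i j hij => ⟨?_, ?_⟩⟩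
    · refine Finset.disjoint_left.2 fun x hx hxs => ?_
      exact key x i (Finset.mem_of_mem_erase hx) (Finset.ne_of_mem_erase hx) hxs
    · have h0 := Finset.disjoint_left.1 (ht.2 i j hij).1
      refine Finset.disjoint_left.2 fun x hx hx' => ?_
      rcases mem_leaves_graft.1 hx with ⟨h1, h2⟩ | ⟨h1, h2⟩ <;>
        rcases mem_leaves_graft.1 hx' with ⟨h3, h4⟩ | ⟨h3, h4⟩
      · exact h0 h1 h3
      · exact key x i h1 h2 h4
      · exact key x j h3 h4 h2
      · exact h0 h1 h3
    · rw [min_graft hl, min_graft hl]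
      exact (ht.2 i j hij).2

theorem mem_leaves_relabel {φ : ℕ → ℕ} {t : PTree Υ ℕ} {y : ℕ} :
    y ∈ (t.relabel φ).leaves ↔ ∃ x ∈ t.leaves, φ x = y := by
  induction t with
  | leaf x => simp [relabel, leaves, eq_comm]
  | node μ c ih =>
    simp only [relabel, mem_leaves_node, ih]
    grind

theorem isShuffle_relabel {φ : ℕ → ℕ} {t : PTree Υ ℕ} (ht : t.IsShuffle)
    (hφ : StrictMonoOn φ (t.leaves : Set ℕ)) : (t.relabel φ).IsShuffle := by
  induction t with
  | leaf x => simp [relabel, IsShuffle]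
  | node μ c ih =>
    have hsub : ∀ i x, x ∈ (c i).leaves → x ∈ ((node μ c).leaves : Set ℕ) :=
      fun i x hx => mem_leaves_node.2 ⟨i, hx⟩
    refine ⟨fun i => ih i (ht.1 i) (hφ.mono fun x hx => hsub i x hx), fun i j hij => ⟨?_, ?_⟩⟩
    · refine Finset.disjoint_left.2 fun y hy hy' => ?_
      obtain ⟨x, hx, rfl⟩ := mem_leaves_relabel.1 hy
      obtain ⟨x', hx', he⟩ := mem_leaves_relabel.1 hy'
      have := hφ.injOn (hsub j x' hx') (hsub i x hx) he
      subst this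
      exact Finset.disjoint_left.1 (ht.2 i j hij).1 hx hx'
    · obtain ⟨p, hp⟩ := Finset.min_of_nonempty (leaves_nonempty (c i))
      have hpm := Finset.mem_of_min hp
      refine lt_of_le_of_lt (Finset.min_le (mem_leaves_relabel.2 ⟨p, hpm, rfl⟩)) ?_
      obtain ⟨q, hq⟩ := Finset.min_of_nonempty (leaves_nonempty ((c j).relabel φ))
      obtain ⟨x, hx, rfl⟩ := mem_leaves_relabel.1 (Finset.mem_of_min hq)
      rw [hq]
      refine WithTop.coe_lt_coe.2 (hφ (hsub i p hpm) (hsub j x hx) ?_)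
      have h1 := (ht.2 i j hij).2
      rw [hp] at h1
      exact WithTop.coe_lt_coe.1 (h1.trans_le (Finset.min_le hx))

theorem relabel_congr {φ ψ : ℕ → ℕ} {t : PTree Υ ℕ} (h : ∀ x ∈ t.leaves, φ x = ψ x) :
    t.relabel φ = t.relabel ψ := by
  induction t with
  | leaf x => simp [relabel, h x (by simp [leaves])]
  | node μ c ih =>
    simp only [relabel]
    congr 1
    funext i
    exact ih i fun x hx => h x (mem_leaves_node.2 ⟨i, hx⟩)

theorem relabel_id (t : PTree Υ ℕ) : t.relabel id = t := by
  induction t with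
  | leaf x => rfl
  | node μ c ih => simp only [relabel, ih]

theorem relabel_relabel (φ ψ : ℕ → ℕ) (t : PTree Υ ℕ) :
    (t.relabel φ).relabel ψ = t.relabel (ψ ∘ φ) := by
  induction t with
  | leaf x => rfl
  | node μ c ih => simp only [relabel, ih]

theorem relabel_graft {φ α β : ℕ → ℕ} {a a' : ℕ} {t s : PTree Υ ℕ}
    (h0 : ∀ x ∈ t.leaves, x = a ↔ α x = a')
    (h1 : ∀ x ∈ t.leaves, x ≠ a → φ x = α x) (h2 : ∀ x ∈ s.leaves, φ x = β x) :
    (t.graft a s).relabel φ = (t.relabel α).graft a' (s.relabel β) := by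
  induction t with
  | leaf x =>
    have hx : x ∈ (leaf x : PTree Υ ℕ).leaves := by simp [leaves]
    by_cases hxa : x = a
    · have := (h0 x hx).1 hxa
      simp only [graft, relabel, hxa, if_true]
      rw [if_pos (by rw [← hxa]; exact this)]
      exact relabel_congr h2
    · have : α x ≠ a' := fun e => hxa ((h0 x hx).2 e)
      simp [graft, relabel, hxa, this, h1 x hx hxa]
  | node μ c ih =>
    simp only [graft, relabel]
    congr 1
    funext i
    exact ih i (fun x hx => h0 x (mem_leaves_node.2 ⟨i, hx⟩))
      (fun x hx => h1 x (mem_leaves_node.2 ⟨i, hx⟩))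

theorem graft_graft_seq {a b : ℕ} {t s d : PTree Υ ℕ} (h : ∀ x ∈ t.leaves, x ≠ a → x ≠ b) :
    (t.graft a s).graft b d = t.graft a (s.graft b d) := by
  induction t with
  | leaf x =>
    by_cases hx : x = a
    · simp [graft, hx]
    · simp [graft, hx, h x (by simp [leaves]) hx]
  | node μ c ih =>
    simp only [graft]
    congr 1
    funext i
    exact ih i fun x hx => h x (mem_leaves_node.2 ⟨i, hx⟩)

theorem graft_graft_par {a b : ℕ} {t s d : PTree Υ ℕ} (hab : a ≠ b) (hb : b ∉ s.leaves)
    (ha : a ∉ d.leaves) : (t.graft a s).graft b d = (t.graft b d).graft a s := by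
  induction t with
  | leaf x =>
    by_cases hx : x = a
    · subst hx
      simp [graft, hab, graft_of_notMem hb]
    · by_cases hxb : x = b
      · subst hxb
        simp [graft, hx, graft_of_notMem ha]
      · simp [graft, hx, hxb]
  | node μ c ih => simp only [graft, ih]

theorem graft_leaf_self {a : ℕ} (t : PTree Υ ℕ) : t.graft a (leaf a) = t := by
  induction t with
  | leaf x =>
    by_cases hx : x = a <;> simp [graft, hx]
  | node μ c ih => simp only [graft, ih]

end PTree

/-- Shuffle monomials with set of leaf labels `A`. -/
def Monomial (Υ : Generators) (A : Finset ℕ) : Type :=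
  {t : PTree Υ ℕ // t.IsShuffle ∧ t.leaves = A}

/-- The function on `ℕ` given by a map between finite sets of naturals (identity elsewhere). -/
def extendMap {A B : Finset ℕ} (e : A → B) (x : ℕ) : ℕ :=
  if h : x ∈ A then e ⟨x, h⟩ else x

theorem extendMap_of_mem {A B : Finset ℕ} (e : A → B) {x : ℕ} (h : x ∈ A) :
    extendMap e x = e ⟨x, h⟩ := by
  simp [extendMap, h]

namespace Monomial

variable {Υ : Generators}

/-- Order-preserving renumbering of the leaves. -/
def map {A B : Finset ℕ} (e : A ≃o B) (t : Monomial Υ A) : Monomial Υ B :=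
  ⟨t.1.relabel (extendMap e), by
    refine ⟨PTree.isShuffle_relabel t.2.1 ?_, ?_⟩
    · rw [t.2.2]
      intro x hx y hy hxy
      rw [extendMap_of_mem e hx, extendMap_of_mem e hy]
      have : (⟨x, hx⟩ : A) < ⟨y, hy⟩ := hxy
      exact e.lt_iff_lt.2 this
    · ext y
      rw [PTree.mem_leaves_relabel, t.2.2]
      constructor
      · rintro ⟨x, hx, rfl⟩
        rw [extendMap_of_mem e hx]
        exact (e ⟨x, hx⟩).2
      · intro hy
        refine ⟨e.symm ⟨y, hy⟩, (e.symm ⟨y, hy⟩).2, ?_⟩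
        rw [extendMap_of_mem e (e.symm ⟨y, hy⟩).2]
        simp⟩

/-- The trivial tree: the identity operation. -/
def one (a : ℕ) : Monomial Υ {a} := ⟨PTree.leaf a, trivial, rfl⟩

/-- Shuffle composition of shuffle monomials: grafting of trees. -/
def comp {A : Finset ℕ} {a : ℕ} {B C : Finset ℕ} (h : ShGraft A a B C)
    (t : Monomial Υ A) (s : Monomial Υ B) : Monomial Υ C :=
  ⟨t.1.graft a s.1, by
    refine ⟨PTree.isShuffle_graft t.2.1 s.2.1 ?_ ?_, PTree.leaves_graft h.toGraft t.2.2 s.2.2⟩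
    · rw [t.2.2, s.2.2]; exact h.disj
    · rw [s.2.2]; exact h.least⟩

theorem ext_val {A : Finset ℕ} {t s : Monomial Υ A} (h : t.1 = s.1) : t = s := Subtype.ext h

theorem map_refl {A : Finset ℕ} (t : Monomial Υ A) : map (OrderIso.refl A) t = t := by
  apply ext_val
  change t.1.relabel _ = t.1
  conv_rhs => rw [← PTree.relabel_id t.1]
  refine PTree.relabel_congr fun x hx => ?_
  rw [t.2.2] at hx
  rw [extendMap_of_mem _ hx]
  rfl

theorem map_trans {A B C : Finset ℕ} (e : A ≃o B) (e' : B ≃o C) (t : Monomial Υ A) :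
    map (e.trans e') t = map e' (map e t) := by
  apply ext_val
  change t.1.relabel _ = (t.1.relabel _).relabel _
  rw [PTree.relabel_relabel]
  refine PTree.relabel_congr fun x hx => ?_
  rw [t.2.2] at hx
  rw [Function.comp, extendMap_of_mem _ hx, extendMap_of_mem e hx,
    extendMap_of_mem e' (e ⟨x, hx⟩).2]
  rfl

theorem map_one {a b : ℕ} (e : ({a} : Finset ℕ) ≃o ({b} : Finset ℕ)) :
    map e (one a : Monomial Υ {a}) = one b := by
  apply ext_val
  change PTree.leaf (extendMap e a) = PTree.leaf b
  have ha : a ∈ ({a} : Finset ℕ) := Finset.mem_singleton_self a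
  rw [extendMap_of_mem e ha, Finset.mem_singleton.1 (e ⟨a, ha⟩).2]

theorem map_comp {A A' B B' C C' : Finset ℕ} {a a' : ℕ}
    (h : ShGraft A a B C) (h' : ShGraft A' a' B' C')
    (eA : A ≃o A') (eB : B ≃o B') (eC : C ≃o C')
    (hc : GraftCompat a a' eA.toEquiv eB.toEquiv eC.toEquiv)
    (t : Monomial Υ A) (s : Monomial Υ B) :
    map eC (comp h t s) = comp h' (map eA t) (map eB s) := by
  apply ext_val
  change (t.1.graft a s.1).relabel _ = (t.1.relabel _).graft a' (s.1.relabel _)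
  apply PTree.relabel_graft
  · intro x hx
    rw [t.2.2] at hx
    rw [extendMap_of_mem eA hx]
    constructor
    · intro e
      exact hc.root ⟨x, hx⟩ e
    · intro e
      have h2 := hc.root ⟨a, h.mem⟩ rfl
      have h3 : eA ⟨x, hx⟩ = eA ⟨a, h.mem⟩ := Subtype.ext (e.trans h2.symm)
      exact congrArg Subtype.val (eA.injective h3)
  · intro x hx hxa
    rw [t.2.2] at hx
    have hxC : x ∈ C := by
      rw [h.eq]; exact Finset.mem_union_left _ (Finset.mem_erase.2 ⟨hxa, hx⟩)
    rw [extendMap_of_mem eA hx, extendMap_of_mem eC hxC]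
    exact hc.left ⟨x, hx⟩ ⟨x, hxC⟩ rfl hxa
  · intro x hx
    rw [s.2.2] at hx
    have hxC : x ∈ C := by rw [h.eq]; exact Finset.mem_union_right _ hx
    rw [extendMap_of_mem eB hx, extendMap_of_mem eC hxC]
    exact hc.right ⟨x, hx⟩ ⟨x, hxC⟩ rfl

theorem one_comp {a : ℕ} {B : Finset ℕ} (h : ShGraft {a} a B B) (t : Monomial Υ B) :
    comp h (one a) t = t := by
  apply ext_val
  simp [comp, one, PTree.graft]

theorem comp_one {A : Finset ℕ} {a : ℕ} (h : ShGraft A a {a} A) (t : Monomial Υ A) :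
    comp h t (one a) = t :=
  ext_val (PTree.graft_leaf_self t.1)

theorem assoc_seq {A B C D E F : Finset ℕ} {a b : ℕ} (h₁ : ShGraft A a B C)
    (h₂ : ShGraft C b D F) (h₃ : ShGraft B b D E) (h₄ : ShGraft A a E F)
    (t : Monomial Υ A) (s : Monomial Υ B) (l : Monomial Υ D) :
    comp h₂ (comp h₁ t s) l = comp h₄ t (comp h₃ s l) := by
  refine ext_val (PTree.graft_graft_seq fun x hx hxa hxb => ?_)
  rw [t.2.2] at hx
  refine Finset.disjoint_left.1 h₁.disj (Finset.mem_erase.2 ⟨hxa, hx⟩) ?_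
  rw [hxb]
  exact h₃.mem

theorem assoc_par {A B C D E F : Finset ℕ} {a b : ℕ} (hab : a ≠ b) (h₁ : ShGraft A a B C)
    (h₂ : ShGraft C b D F) (h₃ : ShGraft A b D E) (h₄ : ShGraft E a B F)
    (t : Monomial Υ A) (s : Monomial Υ B) (l : Monomial Υ D) :
    comp h₂ (comp h₁ t s) l = comp h₄ (comp h₃ t l) s := by
  refine ext_val (PTree.graft_graft_par hab ?_ ?_)
  · rw [s.2.2]
    exact Finset.disjoint_left.1 h₁.disj (Finset.mem_erase.2 ⟨hab.symm, h₃.mem⟩)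
  · rw [l.2.2]
    exact Finset.disjoint_left.1 h₃.disj (Finset.mem_erase.2 ⟨hab, h₁.mem⟩)

end Monomial

/-- The free shuffle operad: its components are spanned by the shuffle monomials. -/
noncomputable def free (k : Type u) [Field k] (Υ : Generators) : ShuffleOperad.{u, u} k where
  obj A := Monomial Υ A →₀ k
  empty := by
    have : IsEmpty (Monomial Υ ∅) := ⟨fun t => by
      have := PTree.leaves_nonempty t.1
      rw [t.2.2] at this
      exact Finset.not_nonempty_empty this⟩
    infer_instance
  map e := Finsupp.lmapDomain k k (Monomial.map e)
  one a := Finsupp.single (Monomial.one a) 1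
  comp h := Finsupp.linearCombination k fun t => Finsupp.lmapDomain k k (Monomial.comp h t)
  map_refl f := by
    induction f using Finsupp.induction_linear with
    | zero => simp
    | add f g hf hg => rw [_root_.map_add, hf, hg]
    | single t c => simp [Finsupp.mapDomain_single, Monomial.map_refl]
  map_trans e e' f := by
    induction f using Finsupp.induction_linear with
    | zero => simp
    | add f g hf hg => simp only [_root_.map_add, hf, hg]
    | single t c => simp [Finsupp.mapDomain_single, Monomial.map_trans]
  map_one e := by simp [Finsupp.mapDomain_single, Monomial.map_one]
  map_comp h h' eA eB eC hc f g := by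
    induction f using Finsupp.induction_linear with
    | zero => simp
    | add f f' hf hf' => simp only [_root_.map_add, LinearMap.add_apply, hf, hf']
    | single t c =>
      induction g using Finsupp.induction_linear with
      | zero => simp
      | add g g' hg hg' => simp only [_root_.map_add, hg, hg']
      | single s d =>
        simp [-Finsupp.single_mul, Finsupp.mapDomain_single, Monomial.map_comp h h' eA eB eC hc]
  one_comp h f := by
    induction f using Finsupp.induction_linear with
    | zero => simp
    | add f g hf hg => rw [_root_.map_add, hf, hg]
    | single t c => simp [Finsupp.mapDomain_single, Monomial.one_comp]
  comp_one h f := by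
    induction f using Finsupp.induction_linear with
    | zero => simp
    | add f g hf hg => rw [_root_.map_add, LinearMap.add_apply, hf, hg]
    | single t c => simp [Finsupp.mapDomain_single, Monomial.comp_one]
  assoc_seq h₁ h₂ h₃ h₄ f g l := by
    induction f using Finsupp.induction_linear with
    | zero => simp
    | add f f' hf hf' => simp only [_root_.map_add, LinearMap.add_apply, hf, hf']
    | single t c =>
      induction g using Finsupp.induction_linear with
      | zero => simp
      | add g g' hg hg' => simp only [_root_.map_add, LinearMap.add_apply, hg, hg']
      | single s d =>
        induction l using Finsupp.induction_linear with
        | zero => simp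
        | add l l' hl hl' => simp only [_root_.map_add, hl, hl']
        | single r x =>
          simp [-Finsupp.single_mul, Finsupp.mapDomain_single,
            Monomial.assoc_seq h₁ h₂ h₃ h₄, mul_assoc]
  assoc_par hab h₁ h₂ h₃ h₄ f g l := by
    induction f using Finsupp.induction_linear with
    | zero => simp
    | add f f' hf hf' => simp only [_root_.map_add, LinearMap.add_apply, hf, hf']
    | single t c =>
      induction g using Finsupp.induction_linear with
      | zero => simp
      | add g g' hg hg' => simp only [_root_.map_add, LinearMap.add_apply, hg, hg']
      | single s d =>
        induction l using Finsupp.induction_linear with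
        | zero => simp
        | add l l' hl hl' => simp only [_root_.map_add, LinearMap.add_apply, hl, hl']
        | single r x =>
          simp [-Finsupp.single_mul, Finsupp.mapDomain_single,
            Monomial.assoc_par hab h₁ h₂ h₃ h₄, mul_right_comm]

/-! ### Gröbner bases and shuffle regularity -/

/-- An admissible ordering: a total order on the shuffle monomials with given leaf labels,
invariant under order-preserving renumbering and compatible with shuffle compositions. -/
structure AdmissibleOrder (Υ : Generators) where
  lt : ∀ {A : Finset ℕ}, Monomial Υ A → Monomial Υ A → Prop
  irrefl : ∀ {A : Finset ℕ} (t : Monomial Υ A), ¬ lt t t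
  trans : ∀ {A : Finset ℕ} {t s r : Monomial Υ A}, lt t s → lt s r → lt t r
  total : ∀ {A : Finset ℕ} (t s : Monomial Υ A), lt t s ∨ t = s ∨ lt s t
  map : ∀ {A B : Finset ℕ} (e : A ≃o B) {t t' : Monomial Υ A},
    lt t t' → lt (t.map e) (t'.map e)
  comp_left : ∀ {A : Finset ℕ} {a : ℕ} {B C : Finset ℕ} (h : ShGraft A a B C)
    {t t' : Monomial Υ A} (s : Monomial Υ B), lt t t' → lt (t.comp h s) (t'.comp h s)
  comp_right : ∀ {A : Finset ℕ} {a : ℕ} {B C : Finset ℕ} (h : ShGraft A a B C)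
    (t : Monomial Υ A) {s s' : Monomial Υ B}, lt s s' → lt (t.comp h s) (t.comp h s')

section Groebner

variable {k : Type u} [Field k] {Υ : Generators}

/-- `m` is the leading monomial of the (nonzero) element `f` of the free shuffle operad. -/
def AdmissibleOrder.IsLeading (o : AdmissibleOrder Υ) {A : Finset ℕ} (f : Monomial Υ A →₀ k)
    (m : Monomial Υ A) : Prop :=
  m ∈ f.support ∧ ∀ m' ∈ f.support, m' ≠ m → o.lt m' m

/-- The set of monomials of arity `n` that are leading monomials of elements of `G`. -/
def AdmissibleOrder.leadingMonomials (o : AdmissibleOrder Υ)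
    (G : Set (Σ n : ℕ, (Monomial Υ (Finset.Icc 1 n) →₀ k))) (n : ℕ) :
    Set (Monomial Υ (Finset.Icc 1 n)) :=
  {m | ∃ f : Monomial Υ (Finset.Icc 1 n) →₀ k,
    (⟨n, f⟩ : Σ n : ℕ, (Monomial Υ (Finset.Icc 1 n) →₀ k)) ∈ G ∧ o.IsLeading f m}

/-- `G` is a Gröbner basis of the kernel `C` of `φ`, that is, of the ideal of relations:
`G` consists of elements of `C`, and the leading monomials of the elements of `G` generate the
ideal whose components are spanned by the leading monomials of all elements of `C`. -/
def IsGroebnerBasis (o : AdmissibleOrder Υ) {P : ShuffleOperad.{u, v} k}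
    (φ : (free k Υ).Hom P) (G : Set (Σ n : ℕ, (Monomial Υ (Finset.Icc 1 n) →₀ k))) : Prop :=
  (∀ x ∈ G, φ.app (Finset.Icc 1 x.1) x.2 = 0) ∧
  ∀ A : Finset ℕ,
    (free k Υ).idealSpan (fun n => (fun m => Finsupp.single m 1) '' o.leadingMonomials G n) A =
      Submodule.span k {x : Monomial Υ A →₀ k | ∃ (f : Monomial Υ A →₀ k) (m : Monomial Υ A),
        φ.app A f = 0 ∧ o.IsLeading f m ∧ x = Finsupp.single m 1}

/-- A set of shuffle monomials is shuffle regular if it contains, with each monomial, all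
monomials with the same planar skeleton. -/
def ShuffleRegular (M : ∀ n : ℕ, Set (Monomial Υ (Finset.Icc 1 n))) : Prop :=
  ∀ n, ∀ m ∈ M n, ∀ m' : Monomial Υ (Finset.Icc 1 n), m'.1.skeleton = m.1.skeleton → m' ∈ M n

end Groebner

/-- The shuffle operad `P` is (isomorphic to) the quotient of the free shuffle operad on a finite
set of generators by an ideal that has, for some admissible ordering, a finite Gröbner basis
whose set of leading monomials is shuffle regular. -/
def ShuffleOperad.HasShuffleRegularFiniteGroebnerBasis {k : Type u} [Field k]
    (P : ShuffleOperad.{u, v} k) : Prop :=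
  ∃ (Υ : Generators) (φ : (free k Υ).Hom P) (o : AdmissibleOrder Υ)
    (G : Set (Σ n : ℕ, (Monomial Υ (Finset.Icc 1 n) →₀ k))),
    (∀ A, Function.Surjective (φ.app A)) ∧ G.Finite ∧ IsGroebnerBasis o φ G ∧
      ShuffleRegular (o.leadingMonomials G)

/-! ### Growth and generating series -/

/-- Subfactorial growth: for all `A, B > 0` there is `C > 0` with `aₙ < C (n / A) ^ (n / B)` for
all sufficiently large `n`. -/
def Subfactorial (a : ℕ → ℕ) : Prop :=
  ∀ A B : ℝ, 0 < A → 0 < B → ∃ C : ℝ, 0 < C ∧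
    ∀ᶠ n : ℕ in Filter.atTop, (a n : ℝ) < C * ((n : ℝ) / A) ^ ((n : ℝ) / B)

/-- `∑_{n ≥ 1} aₙ zⁿ / n!`. -/
noncomputable def expSeries (a : ℕ → ℕ) : PowerSeries ℚ :=
  PowerSeries.mk fun n => if n = 0 then 0 else (a n : ℚ) / (n.factorial : ℚ)

/-- `∑_{n ≥ 1} aₙ zⁿ`. -/
noncomputable def ordSeries (a : ℕ → ℕ) : PowerSeries ℚ :=
  PowerSeries.mk fun n => if n = 0 then 0 else (a n : ℚ)

/-- A nontrivial homogeneous linear differential equation with constant coefficients. -/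
def SatisfiesConstCoeffODE (F : PowerSeries ℚ) : Prop :=
  ∃ (N : ℕ) (c : ℕ → ℚ), c N ≠ 0 ∧
    ∑ i ∈ Finset.range (N + 1), c i • (PowerSeries.derivative ℚ)^[i] F = 0

/-- The power series is the expansion of a rational function. -/
def IsRationalSeries (F : PowerSeries ℚ) : Prop :=
  ∃ p q : Polynomial ℚ, q ≠ 0 ∧ (q : PowerSeries ℚ) * F = (p : PowerSeries ℚ)

/-- The sequence `a` grows as `g`: for large `n` it is bounded from above by a multiple of `g`,
and from below by a positive multiple of `g` for at least one index in each `w` consecutive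
ones. -/
def GrowsLike (a : ℕ → ℕ) (g : ℕ → ℝ) : Prop :=
  ∃ (c C : ℝ) (w n₀ : ℕ), 0 < c ∧ 0 < C ∧ ∀ n, n₀ ≤ n →
    (a n : ℝ) ≤ C * g n ∧ ∃ j, n ≤ j ∧ j < n + w ∧ c * g j ≤ (a j : ℝ)

/-- The sequence is eventually zero, or it has polynomial growth with an integer exponent, or it
has exponential growth `n ^ d * b ^ n` with `b > 1` and an integer `d`. -/
def PolynomialOrExponentialGrowth (a : ℕ → ℕ) : Prop :=
  (∀ᶠ n in Filter.atTop, a n = 0) ∨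
  (∃ d : ℕ, GrowsLike a fun n => (n : ℝ) ^ d) ∨
  ∃ (b : ℝ) (d : ℕ), 1 < b ∧ GrowsLike a fun n => (n : ℝ) ^ d * b ^ n

end ShOp

/-! Normal monomials, those that are not leading monomials of relations, map to a basis of the
quotient (`finrank_eq_card_normal`). Shuffle regularity makes the ideal of leading monomials blind
to the numbering of the leaves: a monomial lies in it exactly when its planar skeleton contains one
of finitely many patterns (`mon_mem_idealSpan_iff`). Hence the dimension in arity `n` is a sum over
planar trees with `n` leaves avoiding these patterns, each weighted by its number of shuffle
labellings, a product of binomial coefficients (`card_labelings`).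

Pattern avoidance is recognised by a finite bottom-up tree automaton (`run_pattern`). Let `f_q` be
the exponential series of the shuffle trees with state `q`. Removing the root expresses `f_q`
through nested integrals `∫ f_{x_1}' ∫ f_{x_2}' ⋯` of the series of the children (`treeSeries_eq`),
a system that is nonlinear in general. Subfactorial growth forces linearity. Suppose a vertex lies
on a cycle of live states through its input `i`. If `i` is not the last input, or if another input
admits a tree with at least two leaves, then every turn around the cycle multiplies the number of
labellings by at least the current number of leaves; `m` turns give `m!` labellings on a tree of
size linear in `m`, which is too many (`not_subfactorial_of_expanding`). So a cycle passes only
through last inputs whose siblings are bare leaves, and such a vertex of arity `r` contributes the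
`(r - 1)`-fold integral of a single series. All other terms involve only lower strongly connected
components. Climbing through the components, one meets linear systems with constant coefficients
whose inhomogeneous terms have a finite-dimensional span of derivatives, a property stable under
sums, products and antiderivatives (`isDerivFinite_treeSeries`).

Cayley–Hamilton then gives the differential equation. On coefficients it is a linear recurrence,
which is rationality of the ordinary series. Over `ℂ` solutions of a recurrence are eventually
combinations of `z ^ n * n.choose k`; the terms of maximal modulus and degree determine the growth,
and `exists_window_lower_bound` shows that they cannot cancel for long. A base below one forces a
sequence of natural numbers to vanish eventually. -/

namespace ShOp

/-! ### Planar patterns and decompositions of shuffle trees. -/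

namespace PTree

variable {Υ : Generators} {L L' : Type}

/-- The number of leaves. -/
def size : PTree Υ L → ℕ
  | leaf _ => 1
  | node _ c => ∑ i, (c i).size

theorem size_pos (t : PTree Υ L) : 0 < t.size := by
  induction t with
  | leaf x => simp [size]
  | node μ c ih =>
    have := Υ.two_le μ
    exact Finset.sum_pos (fun i _ => ih i) ⟨⟨0, by omega⟩, Finset.mem_univ _⟩

theorem size_relabel (φ : L → L') (t : PTree Υ L) : (t.relabel φ).size = t.size := by
  induction t with
  | leaf x => rfl
  | node μ c ih => simp [relabel, size, ih]

theorem skeleton_relabel (φ : L → L') (t : PTree Υ L) :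
    (t.relabel φ).skeleton = t.skeleton := by
  induction t with
  | leaf x => rfl
  | node μ c ih => exact congrArg (PTree.node μ) (funext ih)

/-- Generators have arity at least two, so every child has a sibling, which carries at least one
leaf. -/
theorem size_child_lt {μ : Υ.op} (c : Fin (Υ.ar μ) → PTree Υ L) (i : Fin (Υ.ar μ)) :
    (c i).size < (node μ c).size := by
  have h2 := Υ.two_le μ
  obtain ⟨j, hj⟩ : ∃ j, j ≠ i := by
    have : Nontrivial (Fin (Υ.ar μ)) := Fin.nontrivial_iff_two_le.2 h2
    exact exists_ne i
  exact Finset.single_lt_sum (f := fun i => (c i).size) hj (Finset.mem_univ _)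
    (Finset.mem_univ _) (size_pos _) (fun _ _ _ => Nat.zero_le _)

theorem card_leaves {t : PTree Υ ℕ} (ht : t.IsShuffle) : t.leaves.card = t.size := by
  induction t with
  | leaf x => simp [leaves, size]
  | node μ c ih =>
    rw [leaves, Finset.card_biUnion, size]
    · exact Finset.sum_congr rfl fun i _ => ih i (ht.1 i)
    · intro i _ j _ hij
      rcases lt_or_gt_of_ne hij with h | h
      · exact (ht.2 i j h).1
      · exact (ht.2 j i h).1.symm

/-- The pattern `p` matches `t` at the root; the leaves of `p` match arbitrary subtrees. -/
inductive TopMatch : PTree Υ Unit → PTree Υ L → Prop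
  | leaf (x : Unit) (t : PTree Υ L) : TopMatch (leaf x) t
  | node {μ : Υ.op} {d : Fin (Υ.ar μ) → PTree Υ Unit} {c : Fin (Υ.ar μ) → PTree Υ L} :
      (∀ i, TopMatch (d i) (c i)) → TopMatch (node μ d) (node μ c)

theorem topMatch_node {μ : Υ.op} {d : Fin (Υ.ar μ) → PTree Υ Unit}
    {c : Fin (Υ.ar μ) → PTree Υ L} :
    TopMatch (node μ d) (node μ c) ↔ ∀ i, TopMatch (d i) (c i) := by
  refine ⟨fun h => ?_, TopMatch.node⟩
  cases h with
  | node h => exact h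

/-- The pattern `p` matches `t` at some vertex or leaf of `t`. -/
inductive Contains (p : PTree Υ Unit) : PTree Υ L → Prop
  | top {t : PTree Υ L} : TopMatch p t → Contains p t
  | child {μ : Υ.op} {c : Fin (Υ.ar μ) → PTree Υ L} (i : Fin (Υ.ar μ)) :
      Contains p (c i) → Contains p (node μ c)

theorem contains_node {p : PTree Υ Unit} {μ : Υ.op} {c : Fin (Υ.ar μ) → PTree Υ L} :
    Contains p (node μ c) ↔ TopMatch p (node μ c) ∨ ∃ i, Contains p (c i) := by
  constructor
  · intro h
    cases h with
    | top h => exact Or.inl h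
    | child i h => exact Or.inr ⟨i, h⟩
  · rintro (h | ⟨i, h⟩)
    · exact .top h
    · exact .child i h

theorem contains_leaf {p : PTree Υ Unit} {x : L} :
    Contains p (leaf x) ↔ TopMatch p (leaf x) := by
  constructor
  · intro h
    cases h with
    | top h => exact h
  · exact .top

theorem topMatch_relabel {φ : L → L'} {p : PTree Υ Unit} {t : PTree Υ L} :
    TopMatch p (t.relabel φ) ↔ TopMatch p t := by
  induction p generalizing t with
  | leaf x => exact ⟨fun _ => .leaf _ _, fun _ => .leaf _ _⟩
  | node μ d ih =>
    cases t with
    | leaf x => constructor <;> intro h <;> cases h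
    | node ν c =>
      by_cases hμ : μ = ν
      · subst hμ
        simp only [relabel, topMatch_node, ih]
      · constructor <;> intro h <;> cases h <;> exact absurd rfl hμ

theorem contains_relabel {φ : L → L'} {p : PTree Υ Unit} {t : PTree Υ L} :
    Contains p (t.relabel φ) ↔ Contains p t := by
  induction t with
  | leaf x => rw [relabel, contains_leaf, contains_leaf]; exact topMatch_relabel (t := leaf x)
  | node μ c ih =>
    rw [contains_node, relabel, contains_node]
    simp only [ih]
    exact or_congr_left (topMatch_relabel (t := node μ c))

theorem contains_skeleton {p : PTree Υ Unit} {t : PTree Υ L} :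
    Contains p t.skeleton ↔ Contains p t := contains_relabel

/-- Grafting alters a tree only at a leaf, and a pattern matching there is itself a leaf, which
matches anything. -/
theorem topMatch_graft {p : PTree Υ Unit} {t s : PTree Υ ℕ} {a : ℕ} (h : TopMatch p t) :
    TopMatch p (t.graft a s) := by
  induction h with
  | leaf x t => exact .leaf _ _
  | node _ ih => exact .node ih

theorem contains_graft_left {p : PTree Υ Unit} {t s : PTree Υ ℕ} {a : ℕ} (h : Contains p t) :
    Contains p (t.graft a s) := by
  induction h with
  | top h => exact .top (topMatch_graft h)
  | child i _ ih => exact .child i ih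

theorem contains_graft_right {p : PTree Υ Unit} {t s : PTree Υ ℕ} {a : ℕ} (ha : a ∈ t.leaves)
    (h : Contains p s) : Contains p (t.graft a s) := by
  induction t with
  | leaf x =>
    have : x = a := by simpa [leaves, eq_comm] using ha
    simpa [graft, this] using h
  | node μ c ih =>
    obtain ⟨i, hi⟩ := mem_leaves_node.1 ha
    exact .child i (ih i hi)

/-- A decomposition of a shuffle tree as a shuffle composition. -/
structure IsGraft (t t' : PTree Υ ℕ) (a : ℕ) (s : PTree Υ ℕ) : Prop where
  eq : t = t'.graft a s
  left : t'.IsShuffle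
  right : s.IsShuffle
  mem : a ∈ t'.leaves
  disj : Disjoint (t'.leaves.erase a) s.leaves
  least : IsLeast (s.leaves : Set ℕ) a

theorem isLeast_min' (t : PTree Υ ℕ) :
    IsLeast (t.leaves : Set ℕ) (t.leaves.min' t.leaves_nonempty) :=
  Finset.isLeast_min' _ _

/-- Cutting `s` off and leaving its least label `a` changes no minimum, so the order of the inputs
at the root is undisturbed. -/
theorem IsGraft.node {μ : Υ.op} {c : Fin (Υ.ar μ) → PTree Υ ℕ} (ht : (node μ c).IsShuffle)
    {i : Fin (Υ.ar μ)} {t' s : PTree Υ ℕ} {a : ℕ} (h : IsGraft (c i) t' a s) :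
    IsGraft (node μ c) (node μ (Function.update c i t')) a s := by
  have hsub : s.leaves ⊆ (c i).leaves := fun x hx => by
    rw [h.eq, mem_leaves_graft]; exact Or.inr ⟨h.mem, hx⟩
  have hsub' : t'.leaves ⊆ (c i).leaves := fun x hx => by
    rw [h.eq, mem_leaves_graft]
    by_cases hxa : x = a
    · exact Or.inr ⟨h.mem, hxa ▸ h.least.1⟩
    · exact Or.inl ⟨hx, hxa⟩
  have hmin : t'.leaves.min = (c i).leaves.min := by rw [h.eq, min_graft h.least]
  have hdis : ∀ j, j ≠ i → Disjoint (c j).leaves (c i).leaves := fun j hj => by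
    rcases lt_or_gt_of_ne hj with h | h
    · exact (ht.2 j i h).1
    · exact (ht.2 i j h).1.symm
  have hsubU : ∀ j, (Function.update c i t' j).leaves ⊆ (c j).leaves := fun j => by
    by_cases hj : j = i
    · subst hj; simpa using hsub'
    · simp [hj]
  have hminU : ∀ j, (Function.update c i t' j).leaves.min = (c j).leaves.min := fun j => by
    by_cases hj : j = i
    · subst hj; simpa using hmin
    · simp [hj]
  refine ⟨?_, ⟨fun j => ?_, fun j l hjl => ⟨?_, ?_⟩⟩, h.right, ?_, ?_, h.least⟩
  · simp only [graft]
    congr 1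
    funext j
    by_cases hj : j = i
    · subst hj; simpa using h.eq
    · have : a ∉ (c j).leaves := fun hm =>
        Finset.disjoint_left.1 (hdis j hj) hm (hsub h.least.1)
      simp [hj, graft_of_notMem this]
  · by_cases hj : j = i
    · subst hj; simpa using h.left
    · simpa [hj] using ht.1 j
  · exact (ht.2 j l hjl).1.mono (hsubU j) (hsubU l)
  · rw [hminU, hminU]; exact (ht.2 j l hjl).2
  · exact mem_leaves_node.2 ⟨i, by simpa using h.mem⟩
  · refine Finset.disjoint_left.2 fun x hx hxs => ?_
    obtain ⟨hxa, hx⟩ := Finset.mem_erase.1 hx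
    obtain ⟨j, hj⟩ := mem_leaves_node.1 hx
    by_cases hji : j = i
    · subst hji
      rw [Function.update_self] at hj
      exact Finset.disjoint_left.1 h.disj (Finset.mem_erase.2 ⟨hxa, hj⟩) hxs
    · exact Finset.disjoint_left.1 (hdis j hji) (hsubU j hj) (hsub hxs)

theorem isGraft_root {t : PTree Υ ℕ} (ht : t.IsShuffle) :
    IsGraft t (leaf (t.leaves.min' t.leaves_nonempty)) (t.leaves.min' t.leaves_nonempty) t where
  eq := by simp [graft]
  left := trivial
  right := ht
  mem := by simp [leaves]
  disj := by simp [leaves]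
  least := isLeast_min' t

/-- If the match does not exhaust the tree, some leaf of the pattern covers a nontrivial subtree.
Replacing that subtree by its least label keeps the match and lowers the size. -/
theorem exists_isGraft_of_topMatch {p : PTree Υ Unit} {t : PTree Υ ℕ} (ht : t.IsShuffle)
    (h : TopMatch p t) : t.skeleton = p ∨
      ∃ t' a s, IsGraft t t' a s ∧ TopMatch p t' ∧ t'.size < t.size := by
  induction h with
  | leaf x t =>
    cases t with
    | leaf y => exact Or.inl rfl
    | node μ c =>
      -- A leaf pattern covers the whole tree, so all of it is cut off.
      refine Or.inr ⟨_, _, _, isGraft_root ht, .leaf _ _, ?_⟩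
      have h2 := Υ.two_le μ
      exact (Nat.succ_le_of_lt (size_pos (c ⟨0, by omega⟩))).trans_lt (size_child_lt c _)
  | @node μ d c hm ih =>
    by_cases hall : ∀ i, (c i).skeleton = d i
    · left
      change node μ _ = _
      congr 1
      funext i
      exact hall i
    · right
      push Not at hall
      obtain ⟨i, hi⟩ := hall
      obtain ⟨t', a, s, hg, hp, hs⟩ := (ih i (ht.1 i)).resolve_left hi
      refine ⟨_, a, s, hg.node ht, ?_, ?_⟩
      · refine .node fun j => ?_
        by_cases hj : j = i
        · subst hj; simpa using hp
        · simpa [hj] using hm j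
      · refine Finset.sum_lt_sum (fun j _ => ?_) ⟨i, Finset.mem_univ _, by simpa using hs⟩
        by_cases hj : j = i
        · subst hj; simpa using hs.le
        · simp [hj]

theorem IsGraft.shGraft {t t' s : PTree Υ ℕ} {a : ℕ} (h : IsGraft t t' a s) :
    ShGraft t'.leaves a s.leaves t.leaves where
  mem := h.mem
  disj := h.disj
  eq := by
    rw [h.eq]
    exact leaves_graft ⟨h.mem, h.disj, rfl⟩ rfl rfl
  least := h.least

theorem exists_isGraft_child {μ : Υ.op} {c : Fin (Υ.ar μ) → PTree Υ ℕ}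
    (ht : (PTree.node μ c).IsShuffle) (i : Fin (Υ.ar μ)) :
    ∃ t' a, IsGraft (PTree.node μ c) t' a (c i) :=
  ⟨_, _, (isGraft_root (ht.1 i)).node ht⟩

theorem finite_setOf_size_le (A : Finset ℕ) (n : ℕ) :
    {t : PTree Υ ℕ | t.size ≤ n ∧ t.leaves ⊆ A}.Finite := by
  have := Υ.finite
  induction n with
  | zero =>
    refine Set.finite_empty.subset fun t ht => ?_
    have := size_pos t
    have := ht.1
    omega
  | succ n ih =>
    refine ((A.finite_toSet.image PTree.leaf).union (Set.finite_iUnion fun μ : Υ.op =>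
      (Set.Finite.pi fun _ : Fin (Υ.ar μ) => ih).image (PTree.node μ))).subset ?_
    rintro (x | ⟨μ, c⟩) ⟨h1, h2⟩
    · exact Or.inl ⟨x, h2 (by simp [leaves]), rfl⟩
    · refine Or.inr (Set.mem_iUnion.2 ⟨μ, c, fun i _ => ⟨?_, ?_⟩, rfl⟩)
      · have := size_child_lt c i
        omega
      · exact fun x hx => h2 (mem_leaves_node.2 ⟨i, hx⟩)

theorem finite_setOf_size_eq (n : ℕ) : {s : PTree Υ Unit | s.size = n}.Finite := by
  refine ((finite_setOf_size_le (Υ := Υ) {0} n).image skeleton).subset fun s hs => ?_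
  -- Every leaf gets the label `0`, which reduces to trees labelled by `{0}`.
  refine ⟨s.relabel fun _ => 0, ⟨(size_relabel _ _).trans_le hs.le, fun y hy => ?_⟩, ?_⟩
  · clear hs
    induction s with
    | leaf x => simpa [relabel, leaves] using hy
    | node μ c ih =>
      obtain ⟨i, hi⟩ := mem_leaves_node.1 hy
      exact ih i hi
  · clear hs
    induction s with
    | leaf x => rfl
    | node μ c ih => exact congrArg (PTree.node μ) (funext ih)

/-- The trees with `n` leaves. -/
noncomputable def ofSize (Υ : Generators) (n : ℕ) : Finset (PTree Υ Unit) :=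
  (finite_setOf_size_eq n).toFinset

theorem mem_ofSize {n : ℕ} {s : PTree Υ Unit} : s ∈ ofSize Υ n ↔ s.size = n := by
  simp [ofSize]

end PTree

instance finite_monomial (Υ : Generators) (A : Finset ℕ) : Finite (Monomial Υ A) :=
  ((PTree.finite_setOf_size_le A A.card).subset fun t (ht : t.IsShuffle ∧ t.leaves = A) =>
    ⟨by rw [← PTree.card_leaves ht.1, ht.2], ht.2.subset⟩).to_subtype

/-! ### Monomial ideals, normal monomials and dimensions. -/

section Normal

open PTree

variable {k : Type u} [Field k] {Υ : Generators}

/-- A shuffle monomial as an element of the free shuffle operad. -/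
noncomputable def mon (k : Type u) [Field k] {A : Finset ℕ} (t : Monomial Υ A) :
    (free k Υ).obj A :=
  (Finsupp.single t 1 : Monomial Υ A →₀ k)

theorem free_comp_mon {A B C : Finset ℕ} {a : ℕ} (h : ShGraft A a B C) (t : Monomial Υ A)
    (s : Monomial Υ B) : (free k Υ).comp h (mon k t) (mon k s) = mon k (t.comp h s) := by
  change Finsupp.linearCombination k (fun t => Finsupp.lmapDomain k k (Monomial.comp h t))
    (Finsupp.single t 1) (Finsupp.single s 1) = Finsupp.single (t.comp h s) 1
  simp [Finsupp.mapDomain_single]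

theorem free_map_mon {A B : Finset ℕ} (e : A ≃o B) (t : Monomial Υ A) :
    (free k Υ).map e (mon k t) = mon k (t.map e) :=
  Finsupp.mapDomain_single

theorem span_range_mon (A : Finset ℕ) :
    Submodule.span k (Set.range (mon k : Monomial Υ A → (free k Υ).obj A)) = ⊤ := by
  refine eq_top_iff.2 fun f _ => ?_
  change Monomial Υ A →₀ k at f
  induction f using Finsupp.induction_linear with
  | zero => exact Submodule.zero_mem _
  | add f g hf hg => exact Submodule.add_mem _ (hf trivial) (hg trivial)
  | single t c =>
    have : (Finsupp.single t c : Monomial Υ A →₀ k) = c • Finsupp.single t 1 := by simp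
    rw [this]
    exact Submodule.smul_mem _ c (Submodule.subset_span ⟨t, rfl⟩)

/-- The tree contains one of the patterns. -/
def Divisible {L : Type} (S : Set (PTree Υ Unit)) (t : PTree Υ L) : Prop := ∃ p ∈ S, Contains p t

/-- A tree containing a pattern arises from a monomial with that skeleton by shuffle compositions:
subtrees are grafted onto the leaves of the pattern, and the result is grafted into the rest of the
tree. -/
theorem single_mem_of_divisible (I : (free k Υ).OpIdeal) {S : Set (PTree Υ Unit)}
    (hS : ∀ (A : Finset ℕ) (t : Monomial Υ A), t.1.skeleton ∈ S →
      mon k t ∈ I.carrier A)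
    {A : Finset ℕ} (t : Monomial Υ A) (h : Divisible S t.1) :
    mon k t ∈ I.carrier A := by
  obtain ⟨t, ht, rfl⟩ := t
  obtain ⟨p, hp, hc⟩ := h
  dsimp only at hc
  have comp_mem : ∀ {t t' s : PTree Υ ℕ} {a : ℕ} (hg : IsGraft t t' a s) (ht : t.IsShuffle),
      mon k (⟨t', hg.left, rfl⟩ : Monomial Υ t'.leaves) ∈ I.carrier t'.leaves ∨
      mon k (⟨s, hg.right, rfl⟩ : Monomial Υ s.leaves) ∈ I.carrier s.leaves →
      mon k (⟨t, ht, rfl⟩ : Monomial Υ t.leaves) ∈ I.carrier t.leaves := by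
    intro t t' s a hg ht hor
    have e : (free k Υ).comp hg.shGraft (mon k ⟨t', hg.left, rfl⟩) (mon k ⟨s, hg.right, rfl⟩) =
        mon k (⟨t, ht, rfl⟩ : Monomial Υ t.leaves) :=
      (free_comp_mon _ _ _).trans (congrArg (mon k) (Monomial.ext_val hg.eq.symm))
    rcases hor with h | h
    · exact e ▸ I.comp_mem_left _ _ h
    · exact e ▸ I.comp_mem_right _ _ h
  -- For a match at the root, subtrees above the pattern are cut off one at a time; the number of
  -- leaves drops until the skeleton is the pattern itself.
  have htop : ∀ (n : ℕ) (t : PTree Υ ℕ) (ht : t.IsShuffle), t.size = n → TopMatch p t →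
      mon k (⟨t, ht, rfl⟩ : Monomial Υ t.leaves) ∈ I.carrier t.leaves := by
    intro n
    induction n using Nat.strong_induction_on with
    | _ n ih =>
      intro t ht hn hm
      rcases exists_isGraft_of_topMatch ht hm with h | ⟨t', a, s, hg, hm', hs⟩
      · exact hS _ ⟨t, ht, rfl⟩ (by rw [h]; exact hp)
      · exact comp_mem hg ht (Or.inl (ih t'.size (hn ▸ hs) t' hg.left rfl hm'))
  induction hc with
  | top h => exact htop _ _ ht rfl h
  | child i h ih =>
    obtain ⟨t', a, hg⟩ := exists_isGraft_child ht i
    exact comp_mem hg ht (Or.inr (ih (ht.1 i)))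

/-- The monomial ideal spanned by the monomials that contain a pattern from `S`. -/
noncomputable def divisibleIdeal (k : Type u) [Field k] (S : Set (PTree Υ Unit)) :
    (free k Υ).OpIdeal where
  carrier A := Submodule.span k (mon k '' {t : Monomial Υ A | Divisible S t.1})
  map_mem {A B} e f hf := by
    induction hf using Submodule.span_induction with
    | mem x hx =>
      obtain ⟨t, ⟨p, hp, hc⟩, rfl⟩ := hx
      rw [free_map_mon]
      exact Submodule.subset_span ⟨_, ⟨p, hp, contains_relabel.2 hc⟩, rfl⟩
    | zero => rw [map_zero]; exact Submodule.zero_mem _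
    | add x y _ _ hx hy => rw [map_add]; exact Submodule.add_mem _ hx hy
    | smul c x _ hx => rw [map_smul]; exact Submodule.smul_mem _ c hx
  comp_mem_left {A a B C} h f g hf := by
    have hg : g ∈ Submodule.span k (Set.range (mon k : Monomial Υ B → _)) := by
      rw [span_range_mon]; trivial
    induction hf using Submodule.span_induction with
    | mem x hx =>
      obtain ⟨t, ⟨p, hp, hc⟩, rfl⟩ := hx
      induction hg using Submodule.span_induction with
      | mem y hy =>
        obtain ⟨s, rfl⟩ := hy
        rw [free_comp_mon]
        exact Submodule.subset_span ⟨_, ⟨p, hp, contains_graft_left hc⟩, rfl⟩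
      | zero => rw [map_zero]; exact Submodule.zero_mem _
      | add x y _ _ hx hy => rw [map_add]; exact Submodule.add_mem _ hx hy
      | smul c x _ hx => rw [map_smul]; exact Submodule.smul_mem _ c hx
    | zero => rw [map_zero]; exact Submodule.zero_mem _
    | add x y _ _ hx hy => rw [map_add]; exact Submodule.add_mem _ hx hy
    | smul c x _ hx => rw [map_smul]; exact Submodule.smul_mem _ c hx
  comp_mem_right {A a B C} h f g hg := by
    have hf : f ∈ Submodule.span k (Set.range (mon k : Monomial Υ A → _)) := by
      rw [span_range_mon]; trivial
    induction hg using Submodule.span_induction with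
    | mem x hx =>
      obtain ⟨s, ⟨p, hp, hc⟩, rfl⟩ := hx
      induction hf using Submodule.span_induction with
      | mem y hy =>
        obtain ⟨t, rfl⟩ := hy
        rw [free_comp_mon]
        refine Submodule.subset_span ⟨_, ⟨p, hp, contains_graft_right ?_ hc⟩, rfl⟩
        rw [t.2.2]
        exact h.mem
      | zero => rw [map_zero]; exact Submodule.zero_mem _
      | add x y _ _ hx hy => rw [map_add]; exact Submodule.add_mem _ hx hy
      | smul c x _ hx => rw [map_smul]; exact Submodule.smul_mem _ c hx
    | zero => rw [map_zero]; exact Submodule.zero_mem _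
    | add x y _ _ hx hy => rw [map_add]; exact Submodule.add_mem _ hx hy
    | smul c x _ hx => rw [map_smul]; exact Submodule.smul_mem _ c hx

/-- The planar skeletons of the monomials in `M`. -/
def skeletons (M : ∀ n : ℕ, Set (Monomial Υ (Finset.Icc 1 n))) : Set (PTree Υ Unit) :=
  {p | ∃ n, ∃ m ∈ M n, m.1.skeleton = p}

theorem mon_mem_span_iff {A : Finset ℕ} (T : Set (Monomial Υ A)) (t : Monomial Υ A) :
    mon k t ∈ Submodule.span k (mon k '' T) ↔ t ∈ T := by
  have h : Submodule.span k (mon k '' T) = Finsupp.supported k k T :=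
    (Finsupp.supported_eq_span_single k T).symm
  rw [h]
  refine (Finsupp.mem_supported k _).trans ?_
  change ((Finsupp.single t (1 : k)).support : Set (Monomial Υ A)) ⊆ T ↔ _
  rw [Finsupp.support_single _ one_ne_zero]
  simp

/-- One inclusion tests the generated ideal against `divisibleIdeal`, which is spanned by monomials.
The other needs every numbering of a pattern to be available, and this is what regularity provides.
-/
theorem mon_mem_idealSpan_iff {M : ∀ n : ℕ, Set (Monomial Υ (Finset.Icc 1 n))}
    (hM : ShuffleRegular M) {A : Finset ℕ} (t : Monomial Υ A) :
    mon k t ∈ (free k Υ).idealSpan (fun n => (fun m => mon k m) '' M n) A ↔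
      Divisible (skeletons M) t.1 := by
  constructor
  · intro h
    simp only [ShuffleOperad.idealSpan, Submodule.mem_iInf] at h
    refine (mon_mem_span_iff (k := k) _ t).1 (h (divisibleIdeal k (skeletons M)) fun n => ?_)
    rintro _ ⟨m, hm, rfl⟩
    refine Submodule.subset_span ⟨m, ⟨_, ⟨n, m, hm, rfl⟩, ?_⟩, rfl⟩
    refine .top ?_
    generalize m.1 = t
    induction t with
    | leaf x => exact .leaf _ _
    | node μ c ih => exact .node ih
  · intro h
    simp only [ShuffleOperad.idealSpan, Submodule.mem_iInf]
    intro I hI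
    refine single_mem_of_divisible I (fun B s hs => ?_) t h
    obtain ⟨n, m, hm, he⟩ := hs
    have hcard : (Finset.Icc 1 n).card = B.card := by
      rw [← m.2.2, ← s.2.2, card_leaves m.2.1, card_leaves s.2.1,
        ← size_relabel (fun _ => ()) m.1, ← size_relabel (fun _ => ()) s.1]
      exact congrArg size he
    -- Regularity concerns the labels `1, …, n` only, so `s` is renumbered to these, placed in `M
    -- n`, and carried back by the ideal's stability under renumbering.
    let e : Finset.Icc 1 n ≃o B :=
      ((Finset.Icc 1 n).orderIsoOfFin hcard).symm.trans (B.orderIsoOfFin rfl)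
    have h1 : s.map e.symm ∈ M n := hM n m hm _ ((skeleton_relabel _ _).trans he.symm)
    have h2 := I.map_mem e (hI n ⟨_, h1, rfl⟩)
    rw [free_map_mon, ← Monomial.map_trans, OrderIso.symm_trans_self, Monomial.map_refl] at h2
    exact h2

theorem exists_isLeading (o : AdmissibleOrder Υ) {A : Finset ℕ} {f : Monomial Υ A →₀ k}
    (hf : f ≠ 0) : ∃ m, o.IsLeading f m := by
  classical
  let := Classical.decRel (fun a b : Monomial Υ A => o.lt a b ∨ a = b)
  let : LinearOrder (Monomial Υ A) :=
    { le := fun a b => o.lt a b ∨ a = b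
      lt := o.lt
      le_refl := fun a => Or.inr rfl
      le_trans := by
        rintro a b c (h | rfl) (h' | rfl)
        · exact Or.inl (o.trans h h')
        · exact Or.inl h
        · exact Or.inl h'
        · exact Or.inr rfl
      le_antisymm := by
        rintro a b (h | rfl) (h' | h')
        · exact absurd (o.trans h h') (o.irrefl _)
        · exact h'.symm
        · rfl
        · rfl
      lt_iff_le_not_ge := by
        intro a b
        constructor
        · intro h
          refine ⟨Or.inl h, ?_⟩
          rintro (h' | rfl)
          · exact o.irrefl _ (o.trans h h')
          · exact o.irrefl _ h
        · rintro ⟨h | rfl, h'⟩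
          · exact h
          · exact absurd (Or.inr rfl) h'
      le_total := by
        intro a b
        rcases o.total a b with h | h | h
        · exact Or.inl (Or.inl h)
        · exact Or.inl (Or.inr h)
        · exact Or.inr (Or.inl h)
      toDecidableLE := inferInstance }
  have hne : f.support.Nonempty := Finsupp.support_nonempty_iff.2 hf
  exact ⟨f.support.max' hne, f.support.max'_mem hne, fun m' hm' hne' =>
    lt_of_le_of_ne (f.support.le_max' m' hm') hne'⟩

/-- The images of the monomials that are not leading monomials of relations form a basis of the
quotient. -/
theorem finrank_eq_card_normal (o : AdmissibleOrder Υ) {A : Finset ℕ} {V : Type v}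
    [AddCommGroup V] [Module k V] (φ : (Monomial Υ A →₀ k) →ₗ[k] V)
    (hφ : Function.Surjective φ) :
    Module.finrank k V =
      Nat.card {t : Monomial Υ A // ¬ ∃ f, φ f = 0 ∧ o.IsLeading f t} := by
  let N := {t : Monomial Υ A // ¬ ∃ f, φ f = 0 ∧ o.IsLeading f t}
  let ψ : (N →₀ k) →ₗ[k] V := φ ∘ₗ Finsupp.lmapDomain k k Subtype.val
  have hinj : Function.Injective ψ := by
    refine (injective_iff_map_eq_zero ψ).2 fun g hg => ?_
    by_contra hne
    have hne' : Finsupp.mapDomain Subtype.val g ≠ 0 := fun h0 =>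
      hne (Finsupp.mapDomain_injective Subtype.val_injective (h0.trans Finsupp.mapDomain_zero.symm))
    obtain ⟨m, hm⟩ := exists_isLeading o hne'
    classical
    obtain ⟨n, hn, rfl⟩ := Finset.mem_image.1 (Finsupp.mapDomain_support hm.1)
    exact n.2 ⟨_, hg, hm⟩
  -- There are finitely many monomials with labels `A`, so rewriting to smaller monomials
  -- terminates.
  have hwf : WellFounded (fun a b : Monomial Υ A => o.lt a b) := by
    have : IsTrans (Monomial Υ A) (fun a b => o.lt a b) := ⟨fun _ _ _ => o.trans⟩
    have : Std.Irrefl (fun a b : Monomial Υ A => o.lt a b) := ⟨o.irrefl⟩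
    exact Finite.wellFounded_of_trans_of_irrefl _
  have hsingle : ∀ t : Monomial Υ A, φ (Finsupp.single t 1) ∈ LinearMap.range ψ := by
    intro t
    induction t using hwf.induction with
    | _ t ih =>
      by_cases ht : ∃ f, φ f = 0 ∧ o.IsLeading f t
      · obtain ⟨f, hf, hl⟩ := ht
        have h1 : f t • φ (Finsupp.single t 1) ∈ LinearMap.range ψ := by
          -- The relation `f` with leading monomial `t` expresses the image of `t` through smaller
          -- monomials.
          have h2 : f t • φ (Finsupp.single t 1) = - φ (f.erase t) := by
            rw [eq_neg_iff_add_eq_zero, ← map_smul, ← map_add, Finsupp.smul_single, smul_eq_mul,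
              mul_one, Finsupp.single_add_erase, hf]
          rw [h2]
          refine Submodule.neg_mem _ ?_
          rw [← Finsupp.sum_single (f.erase t), map_finsuppSum]
          refine Submodule.sum_mem _ fun m hm => ?_
          classical
          rw [Finsupp.support_erase, Finset.mem_erase] at hm
          have := Submodule.smul_mem _ (f.erase t m) (ih m (hl.2 m hm.2 hm.1))
          rwa [← map_smul, Finsupp.smul_single, smul_eq_mul, mul_one] at this
        exact (Submodule.smul_mem_iff _ (Finsupp.mem_support_iff.1 hl.1)).1 h1
      · exact ⟨Finsupp.single ⟨t, ht⟩ 1, by simp [ψ, Finsupp.mapDomain_single]⟩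
  have hsurj : Function.Surjective ψ := by
    intro v
    obtain ⟨f, rfl⟩ := hφ v
    change φ f ∈ LinearMap.range ψ
    induction f using Finsupp.induction_linear with
    | zero => rw [map_zero]; exact Submodule.zero_mem _
    | add f g hf hg => rw [map_add]; exact Submodule.add_mem _ hf hg
    | single t c =>
      have := Submodule.smul_mem _ c (hsingle t)
      rwa [← map_smul, Finsupp.smul_single, smul_eq_mul, mul_one] at this
  have := Fintype.ofFinite N
  rw [← (LinearEquiv.ofBijective ψ ⟨hinj, hsurj⟩).finrank_eq, Module.finrank_finsupp_self,
    Nat.card_eq_fintype_card]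

/-- The dimensions of the components of an operad with a finite shuffle regular Gröbner basis
count the shuffle monomials that avoid a finite set of planar patterns. -/
theorem exists_dim_eq_card {P : ShuffleOperad.{u, v} k}
    (hP : P.HasShuffleRegularFiniteGroebnerBasis) :
    ∃ (Υ : Generators) (S : Set (PTree Υ Unit)), S.Finite ∧ ∀ n,
      P.dim n = Nat.card {t : Monomial Υ (Finset.Icc 1 n) // ¬ Divisible S t.1} := by
  obtain ⟨Υ, φ, o, G, hsurj, hG, ⟨-, hgb⟩, hreg⟩ := hP
  refine ⟨Υ, skeletons (o.leadingMonomials G), ?_, fun n => ?_⟩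
  · let F : (Σ n : ℕ, (Monomial Υ (Finset.Icc 1 n) →₀ k)) → Set (PTree Υ Unit) := fun x =>
      {p | ∃ m, o.IsLeading x.2 m ∧ m.1.skeleton = p}
    refine (hG.biUnion (t := F) fun x _ => ?_).subset ?_
    · exact ((x.2.support.finite_toSet.image fun m => m.1.skeleton)).subset
        fun p ⟨m, hm, hp⟩ => ⟨m, hm.1, hp⟩
    · rintro p ⟨n, m, ⟨f, hf, hl⟩, hp⟩
      exact Set.mem_biUnion hf ⟨m, hl, hp⟩
  · refine (finrank_eq_card_normal o (φ.app (Finset.Icc 1 n)) (hsurj _)).trans ?_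
    refine Nat.card_congr (Equiv.subtypeEquivRight fun t => not_congr ?_)
    rw [← mon_mem_idealSpan_iff (k := k) hreg t]
    have h1 := hgb (Finset.Icc 1 n)
    change (free k Υ).idealSpan (fun n => (fun m => mon k m) '' o.leadingMonomials G n) _ = _ at h1
    have h2 : {x : Monomial Υ (Finset.Icc 1 n) →₀ k |
        ∃ (f : Monomial Υ (Finset.Icc 1 n) →₀ k) (m : Monomial Υ (Finset.Icc 1 n)),
          φ.app (Finset.Icc 1 n) f = 0 ∧ o.IsLeading f m ∧ x = Finsupp.single m 1} =
        mon k '' {m | ∃ f, φ.app (Finset.Icc 1 n) f = 0 ∧ o.IsLeading f m} := by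
      ext x
      constructor
      · rintro ⟨f, m, h, h', rfl⟩
        exact ⟨m, ⟨f, h, h'⟩, rfl⟩
      · rintro ⟨m, ⟨f, h, h'⟩, rfl⟩
        exact ⟨f, m, h, h', rfl⟩
    -- Both subspaces in the Gröbner condition are now spans of monomials, so membership can be
    -- compared monomial by monomial.
    rw [h1, h2]
    exact (mon_mem_span_iff (k := k) {m | ∃ f, φ.app (Finset.Icc 1 n) f = 0 ∧ o.IsLeading f m}
      t).symm

end Normal

end ShOp

/-! ### Counting the shuffle labellings of a planar tree. -/

namespace ShOp

namespace PTree

variable {Υ : Generators}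

/-- The number of ordered partitions of a set into blocks of sizes `n 0, n 1, …` with increasing
minima. -/
def shuffleCoeff {r : ℕ} (n : Fin r → ℕ) : ℕ :=
  ∏ i, ((∑ j, if i ≤ j then n j else 0) - 1).choose (n i - 1)

theorem shuffleCoeff_succ {r : ℕ} (n : Fin (r + 1) → ℕ) :
    shuffleCoeff n = ((∑ j, n j) - 1).choose (n 0 - 1) * shuffleCoeff (Fin.tail n) := by
  rw [shuffleCoeff, Fin.prod_univ_succ, shuffleCoeff]
  refine congrArg₂ (· * ·) (by simp) (Finset.prod_congr rfl fun i _ => ?_)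
  rw [Fin.sum_univ_succ]
  simp [Fin.tail, Fin.succ_ne_zero]

/-- The number of shuffle monomials with a given planar skeleton and given labels. -/
def numLabel : PTree Υ Unit → ℕ
  | leaf _ => 1
  | node _ c => shuffleCoeff (fun i => (c i).size) * ∏ i, numLabel (c i)

/-- The number of shuffle labellings of a planar forest. -/
def forestNum {r : ℕ} (c : Fin r → PTree Υ Unit) : ℕ :=
  shuffleCoeff (fun i => (c i).size) * ∏ i, numLabel (c i)

theorem numLabel_node {μ : Υ.op} (c : Fin (Υ.ar μ) → PTree Υ Unit) :
    numLabel (node μ c) = forestNum c := rfl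

theorem forestNum_succ {r : ℕ} (c : Fin (r + 1) → PTree Υ Unit) :
    forestNum c = ((∑ j, (c j).size) - 1).choose ((c 0).size - 1) * numLabel (c 0) *
      forestNum (Fin.tail c) := by
  rw [forestNum, shuffleCoeff_succ, Fin.prod_univ_succ, forestNum]
  unfold Fin.tail
  ring

/-- The shuffle trees with skeleton `s` and set of labels `A`. -/
def labelings (s : PTree Υ Unit) (A : Finset ℕ) : Set (PTree Υ ℕ) :=
  {t | (t.IsShuffle ∧ t.leaves = A) ∧ t.skeleton = s}

/-- The shuffle forests with given skeletons and set of labels `A`. -/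
def forestLabelings {r : ℕ} (c : Fin r → PTree Υ Unit) (A : Finset ℕ) :
    Set (Fin r → PTree Υ ℕ) :=
  {f | ((∀ i, (f i).IsShuffle) ∧
      ∀ i j, i < j → Disjoint (f i).leaves (f j).leaves ∧ (f i).leaves.min < (f j).leaves.min) ∧
    (Finset.univ.biUnion fun i => (f i).leaves) = A ∧ ∀ i, (f i).skeleton = c i}

instance finite_labelings (s : PTree Υ Unit) (A : Finset ℕ) : Finite (labelings s A) :=
  ((finite_setOf_size_le A A.card).subset fun t (ht : (t.IsShuffle ∧ t.leaves = A) ∧ _) =>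
    ⟨by rw [← card_leaves ht.1.1, ht.1.2], ht.1.2.subset⟩).to_subtype

theorem labelings_node {μ : Υ.op} (c : Fin (Υ.ar μ) → PTree Υ Unit) (A : Finset ℕ) :
    labelings (node μ c) A = node μ '' forestLabelings c A := by
  ext t
  constructor
  · rintro ⟨⟨h1, h2⟩, h3⟩
    cases t with
    | leaf x => cases h3
    | node ν f =>
      cases h3
      exact ⟨f, ⟨h1, h2, fun _ => rfl⟩, rfl⟩
  · rintro ⟨f, ⟨h1, h2, h3⟩, rfl⟩
    exact ⟨⟨h1, h2⟩, congrArg (node μ) (funext h3)⟩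

theorem card_of_mem_labelings {s : PTree Υ Unit} {A : Finset ℕ} {t : PTree Υ ℕ}
    (h : t ∈ labelings s A) : A.card = s.size := by
  rw [← h.1.2, card_leaves h.1.1, ← h.2]
  exact (size_relabel _ _).symm

/-- The least label `a` sits on the first tree. The remaining labels `B` of that tree are arbitrary,
and every label left over exceeds `a`, so no further condition links the first tree to the others.
-/
theorem cons_mem_forestLabelings {r : ℕ} {c : Fin (r + 1) → PTree Υ Unit} {A B : Finset ℕ}
    {a : ℕ} (ha : IsLeast (A : Set ℕ) a) (hB : B ⊆ A.erase a) {t : PTree Υ ℕ}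
    {f : Fin r → PTree Υ ℕ} (ht : t ∈ labelings (c 0) (insert a B))
    (hf : f ∈ forestLabelings (Fin.tail c) (A.erase a \ B)) :
    (Fin.cons t f : Fin (r + 1) → PTree Υ ℕ) ∈ forestLabelings c A := by
  obtain ⟨⟨ht1, ht2⟩, ht3⟩ := ht
  obtain ⟨⟨hf1, hf2⟩, hf3, hf4⟩ := hf
  have hsub : ∀ i x, x ∈ (f i).leaves → x ∈ A.erase a \ B := fun i x hx => by
    rw [← hf3]; exact Finset.mem_biUnion.2 ⟨i, Finset.mem_univ _, hx⟩
  have hmin : ∀ i, t.leaves.min < (f i).leaves.min := fun i => by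
    obtain ⟨q, hq⟩ := Finset.min_of_nonempty (leaves_nonempty (f i))
    have hq' := hsub i q (Finset.mem_of_min hq)
    rw [Finset.mem_sdiff, Finset.mem_erase] at hq'
    rw [hq]
    refine (Finset.min_le (a := a) ?_).trans_lt (WithTop.coe_lt_coe.2 ?_)
    · rw [ht2]; exact Finset.mem_insert_self _ _
    · exact lt_of_le_of_ne (ha.2 hq'.1.2) (Ne.symm hq'.1.1)
  have hdis : ∀ i, Disjoint t.leaves (f i).leaves := fun i => by
    refine Finset.disjoint_left.2 fun x hx hx' => ?_
    have := hsub i x hx'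
    rw [ht2, Finset.mem_insert] at hx
    rw [Finset.mem_sdiff, Finset.mem_erase] at this
    tauto
  refine ⟨⟨fun i => ?_, fun i j hij => ?_⟩, ?_, fun i => ?_⟩
  · cases i using Fin.cases with
    | zero => exact ht1
    | succ i => exact hf1 i
  · cases j using Fin.cases with
    | zero => exact absurd hij (Fin.not_lt_zero _)
    | succ j =>
      cases i using Fin.cases with
      | zero => exact ⟨hdis j, hmin j⟩
      | succ i => exact hf2 i j (Fin.succ_lt_succ_iff.1 hij)
  · have : A = insert a B ∪ (A.erase a \ B) := by
      ext x
      have h1 := ha.1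
      have h2 : x ∈ B → x ∈ A.erase a := fun h => hB h
      simp only [Finset.mem_union, Finset.mem_insert, Finset.mem_sdiff, Finset.mem_erase,
        Finset.mem_coe] at h1 h2 ⊢
      grind
    rw [this, ← hf3, ← ht2]
    ext x
    simp [Fin.exists_fin_succ]
  · cases i using Fin.cases with
    | zero => exact ht3
    | succ i => exact hf4 i

/-- Inverse of the preceding construction: increasing minima force `a` onto the first tree. -/
theorem exists_of_mem_forestLabelings {r : ℕ} {c : Fin (r + 1) → PTree Υ Unit} {A : Finset ℕ}
    {a : ℕ} (ha : IsLeast (A : Set ℕ) a) {g : Fin (r + 1) → PTree Υ ℕ}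
    (hg : g ∈ forestLabelings c A) :
    a ∈ (g 0).leaves ∧ (g 0).leaves ⊆ A ∧ g 0 ∈ labelings (c 0) (g 0).leaves ∧
      Fin.tail g ∈ forestLabelings (Fin.tail c) (A \ (g 0).leaves) := by
  obtain ⟨⟨h1, h2⟩, h3, h4⟩ := hg
  have hsub : ∀ i, (g i).leaves ⊆ A := fun i x hx => by
    rw [← h3]; exact Finset.mem_biUnion.2 ⟨i, Finset.mem_univ _, hx⟩
  refine ⟨?_, hsub 0, ⟨⟨h1 0, rfl⟩, h4 0⟩, ⟨fun i => h1 i.succ, fun i j hij =>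
    h2 i.succ j.succ (Fin.succ_lt_succ_iff.2 hij)⟩, ?_, fun i => h4 i.succ⟩
  · have := ha.1
    rw [Finset.mem_coe, ← h3] at this
    obtain ⟨i, -, hi⟩ := Finset.mem_biUnion.1 this
    cases i using Fin.cases with
    | zero => exact hi
    | succ i =>
      have h5 := (h2 0 i.succ (Fin.succ_pos i)).2.trans_le (Finset.min_le hi)
      obtain ⟨q, hq⟩ := Finset.min_of_nonempty (leaves_nonempty (g 0))
      rw [hq] at h5
      exact absurd (ha.2 (hsub 0 (Finset.mem_of_min hq))) (not_le.2 (WithTop.coe_lt_coe.1 h5))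
  · ext x
    simp only [Finset.mem_biUnion, Finset.mem_univ, true_and, Finset.mem_sdiff, Fin.tail]
    constructor
    · rintro ⟨i, hi⟩
      exact ⟨hsub _ hi, fun h0 =>
        Finset.disjoint_left.1 (h2 0 i.succ (Fin.succ_pos i)).1 h0 hi⟩
    · rintro ⟨hx, h0⟩
      rw [← h3] at hx
      obtain ⟨i, -, hi⟩ := Finset.mem_biUnion.1 hx
      cases i using Fin.cases with
      | zero => exact absurd hi h0
      | succ i => exact ⟨i, hi⟩

/-- Peeling off the first tree leaves a choice of its labels other than `a`, counted by a binomial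
coefficient, and two independent labellings. Finiteness is carried through the induction because
counting a disjoint union needs finite fibres. -/
theorem card_forestLabelings {r : ℕ} (c : Fin r → PTree Υ Unit)
    (hc : ∀ i A, A.card = (c i).size → Nat.card (labelings (c i) A) = numLabel (c i))
    (A : Finset ℕ) (hA : A.card = ∑ i, (c i).size) :
    Finite (forestLabelings c A) ∧ Nat.card (forestLabelings c A) = forestNum c := by
  induction r generalizing A with
  | zero =>
    have hA' : A = ∅ := by simpa using hA
    subst hA'
    have : Unique (forestLabelings c ∅) :=
      { default := ⟨Fin.elim0, ⟨fun i => i.elim0, fun i => i.elim0⟩, by simp, fun i => i.elim0⟩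
        uniq := fun f => Subtype.ext (funext fun i => i.elim0) }
    refine ⟨inferInstance, ?_⟩
    rw [Nat.card_unique]
    simp [forestNum, shuffleCoeff]
  | succ r ih =>
    have h0 := size_pos (c 0)
    have hsum : ∑ i, (c i).size = (c 0).size + ∑ i, (Fin.tail c i).size := Fin.sum_univ_succ _
    have hne : A.Nonempty := Finset.card_pos.1 (by omega)
    obtain ⟨a, ha⟩ : ∃ a, IsLeast (A : Set ℕ) a := ⟨_, Finset.isLeast_min' A hne⟩
    have hcard : (A.erase a).card = A.card - 1 := Finset.card_erase_of_mem ha.1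
    let 𝓑 := (A.erase a).powersetCard ((c 0).size - 1)
    have hB : ∀ B : 𝓑, B.1 ⊆ A.erase a ∧ B.1.card = (c 0).size - 1 := fun B =>
      Finset.mem_powersetCard.1 B.2
    have ha' : ∀ B : 𝓑, a ∉ B.1 := fun B h => by simpa using (hB B).1 h
    have h1 : ∀ B : 𝓑, (insert a B.1).card = (c 0).size := fun B => by
      rw [Finset.card_insert_of_notMem (ha' B), (hB B).2]; omega
    have h2 : ∀ B : 𝓑, (A.erase a \ B.1).card = ∑ i, (Fin.tail c i).size := fun B => by
      rw [Finset.card_sdiff_of_subset (hB B).1, (hB B).2, hcard]; omega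
    have ih' := fun B : 𝓑 => ih (Fin.tail c) (fun i => hc i.succ) _ (h2 B)
    have hfin := fun B : 𝓑 => (ih' B).1
    let F : (Σ B : 𝓑, labelings (c 0) (insert a B.1) ×
        forestLabelings (Fin.tail c) (A.erase a \ B.1)) → forestLabelings c A :=
      fun x => ⟨_, cons_mem_forestLabelings ha (hB x.1).1 x.2.1.2 x.2.2.2⟩
    have hF : Function.Bijective F := by
      constructor
      · rintro ⟨B, ⟨t, ht⟩, ⟨f, hf⟩⟩ ⟨B', ⟨t', ht'⟩, ⟨f', hf'⟩⟩ h
        have h' : (Fin.cons t f : Fin (r + 1) → PTree Υ ℕ) = Fin.cons t' f' :=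
          congrArg Subtype.val h
        obtain ⟨rfl, rfl⟩ := Fin.cons_inj.1 h'
        have : B = B' := Subtype.ext <| by
          rw [← Finset.erase_insert (ha' B), ← Finset.erase_insert (ha' B'), ← ht.1.2, ← ht'.1.2]
        subst this
        rfl
      · rintro ⟨g, hg⟩
        obtain ⟨ha0, hsub, ht, hf⟩ := exists_of_mem_forestLabelings ha hg
        have e1 : insert a ((g 0).leaves.erase a) = (g 0).leaves := Finset.insert_erase ha0
        have e2 : A.erase a \ (g 0).leaves.erase a = A \ (g 0).leaves := by
          ext x
          simp only [Finset.mem_sdiff, Finset.mem_erase]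
          grind
        refine ⟨⟨⟨(g 0).leaves.erase a, Finset.mem_powersetCard.2
          ⟨Finset.erase_subset_erase _ hsub, ?_⟩⟩, ⟨g 0, by rw [e1]; exact ht⟩,
          ⟨Fin.tail g, by rw [e2]; exact hf⟩⟩, Subtype.ext (Fin.cons_self_tail g)⟩
        rw [Finset.card_erase_of_mem ha0, card_of_mem_labelings ht]
    refine ⟨Finite.of_surjective F hF.2, ?_⟩
    rw [← Nat.card_congr (Equiv.ofBijective F hF), Nat.card_sigma, forestNum_succ]
    simp only [Nat.card_prod, hc 0 _ (h1 _), (ih' _).2, Finset.sum_const, Finset.card_univ,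
      Fintype.card_coe, smul_eq_mul, 𝓑, Finset.card_powersetCard, hcard, hA, mul_assoc]

theorem card_labelings (s : PTree Υ Unit) (A : Finset ℕ) (hA : A.card = s.size) :
    Nat.card (labelings s A) = numLabel s := by
  induction s generalizing A with
  | leaf x =>
    obtain ⟨a, rfl⟩ := Finset.card_eq_one.1 hA
    have : labelings (leaf x : PTree Υ Unit) {a} = {leaf a} := by
      ext t
      constructor
      · rintro ⟨⟨-, h⟩, h'⟩
        cases t with
        | leaf y => simpa [leaves] using h
        | node μ c => cases h'
      · rintro rfl
        exact ⟨⟨trivial, rfl⟩, rfl⟩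
    rw [this]
    simp [numLabel]
  | node μ c ih =>
    rw [labelings_node, Nat.card_image_of_injective fun f g h => by cases h; rfl, numLabel_node]
    exact (card_forestLabelings c ih A hA).2

/-- Shuffle monomials with a property of the skeleton are counted by skeletons. -/
theorem card_monomial_eq_sum (X : PTree Υ Unit → Prop) [DecidablePred X] (A : Finset ℕ) :
    Nat.card {t : Monomial Υ A // X t.1.skeleton} =
      ∑ s ∈ (ofSize Υ A.card).filter X, numLabel s := by
  let F : (Σ s : (ofSize Υ A.card).filter X, labelings s.1 A) →
      {t : Monomial Υ A // X t.1.skeleton} := fun x => ⟨⟨x.2.1, x.2.2.1⟩, by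
    have h1 := x.2.2.2
    have h2 := (Finset.mem_filter.1 x.1.2).2
    rw [← h1] at h2
    exact h2⟩
  have hF : Function.Bijective F := by
    constructor
    · rintro ⟨⟨s, hs⟩, ⟨t, ht⟩⟩ ⟨⟨s', hs'⟩, ⟨t', ht'⟩⟩ h
      obtain rfl : t = t' := congrArg (fun x => x.1.1) h
      obtain rfl : t.skeleton = s := ht.2
      obtain rfl : t.skeleton = s' := ht'.2
      rfl
    · rintro ⟨⟨t, ht⟩, hX⟩
      refine ⟨⟨⟨t.skeleton, Finset.mem_filter.2 ⟨mem_ofSize.2 ?_, hX⟩⟩, t, ht, rfl⟩, rfl⟩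
      exact (card_of_mem_labelings ⟨ht, rfl⟩).symm
  rw [← Nat.card_congr (Equiv.ofBijective F hF), Nat.card_sigma]
  refine (Finset.sum_congr rfl fun s _ => card_labelings s.1 A ?_).trans
    (Finset.sum_coe_sort ((ofSize Υ A.card).filter X) numLabel)
  exact (mem_ofSize.1 (Finset.mem_filter.1 s.2).1).symm

end PTree

end ShOp

/-! ### Series whose derivatives span a finite-dimensional space. -/

namespace ShOp

open PowerSeries

section DerivFinite

/-- The series lies in a finite-dimensional space of series that is stable under
differentiation. -/
def IsDerivFinite (F : ℚ⟦X⟧) : Prop :=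
  ∃ V : Submodule ℚ ℚ⟦X⟧, FiniteDimensional ℚ V ∧ (∀ v ∈ V, d⁄dX ℚ v ∈ V) ∧ F ∈ V

theorem IsDerivFinite.zero : IsDerivFinite 0 :=
  ⟨⊥, inferInstance, fun v hv => by simp [(Submodule.mem_bot ℚ).1 hv], Submodule.zero_mem _⟩

theorem IsDerivFinite.add {F G : ℚ⟦X⟧} (hF : IsDerivFinite F) (hG : IsDerivFinite G) :
    IsDerivFinite (F + G) := by
  obtain ⟨V, hV, hV', hFV⟩ := hF
  obtain ⟨W, hW, hW', hGW⟩ := hG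
  refine ⟨V ⊔ W, inferInstance, fun v hv => ?_, Submodule.add_mem_sup hFV hGW⟩
  obtain ⟨x, hx, y, hy, rfl⟩ := Submodule.mem_sup.1 hv
  rw [map_add]
  exact Submodule.add_mem_sup (hV' x hx) (hW' y hy)

/-- By the Leibniz rule the product of two stable spaces is stable. -/
theorem IsDerivFinite.mul {F G : ℚ⟦X⟧} (hF : IsDerivFinite F) (hG : IsDerivFinite G) :
    IsDerivFinite (F * G) := by
  obtain ⟨V, hV, hV', hFV⟩ := hF
  obtain ⟨W, hW, hW', hGW⟩ := hG
  refine ⟨V * W, ?_, fun v hv => ?_, Submodule.mul_mem_mul hFV hGW⟩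
  · exact Module.Finite.iff_fg.2 ((Module.Finite.iff_fg.1 hV).mul (Module.Finite.iff_fg.1 hW))
  · induction hv using Submodule.mul_induction_on' with
    | mem_mul_mem x hx y hy =>
      rw [Derivation.leibniz, smul_eq_mul, smul_eq_mul, mul_comm y]
      exact Submodule.add_mem _ (Submodule.mul_mem_mul hx (hW' y hy))
        (Submodule.mul_mem_mul (hV' x hx) hy)
    | add x _ y _ hx hy => rw [map_add]; exact Submodule.add_mem _ hx hy

theorem IsDerivFinite.derivative {F : ℚ⟦X⟧} (hF : IsDerivFinite F) :
    IsDerivFinite (d⁄dX ℚ F) := by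
  obtain ⟨V, hV, hV', hFV⟩ := hF
  exact ⟨V, hV, hV', hV' F hFV⟩

theorem IsDerivFinite.smul (c : ℚ) {F : ℚ⟦X⟧} (hF : IsDerivFinite F) :
    IsDerivFinite (c • F) := by
  obtain ⟨V, hV, hV', hFV⟩ := hF
  exact ⟨V, hV, hV', V.smul_mem c hFV⟩

/-- The space of all series with finite-dimensional span of derivatives. -/
def derivFinite : Submodule ℚ ℚ⟦X⟧ where
  carrier := {F | IsDerivFinite F}
  add_mem' := IsDerivFinite.add
  zero_mem' := IsDerivFinite.zero
  smul_mem' c _ := IsDerivFinite.smul c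

theorem mem_derivFinite {F : ℚ⟦X⟧} : F ∈ derivFinite ↔ IsDerivFinite F := Iff.rfl

/-- Solutions of inhomogeneous linear systems with constant coefficients. -/
theorem IsDerivFinite.of_system {S : Set ℚ⟦X⟧} (hS : S.Finite)
    (h : ∀ F ∈ S, d⁄dX ℚ F ∈ Submodule.span ℚ S ⊔ derivFinite) {F : ℚ⟦X⟧} (hF : F ∈ S) :
    IsDerivFinite F := by
  -- For each unknown, a stable finite-dimensional space absorbs the inhomogeneous term. These
  -- spaces together with the span of the unknowns form a stable space.
  have h' : ∀ F : S, ∃ V : Submodule ℚ ℚ⟦X⟧, FiniteDimensional ℚ V ∧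
      (∀ v ∈ V, d⁄dX ℚ v ∈ V) ∧ d⁄dX ℚ F.1 ∈ Submodule.span ℚ S ⊔ V := by
    intro F
    obtain ⟨x, hx, y, ⟨V, hV, hV', hy⟩, hxy⟩ := Submodule.mem_sup.1 (h F.1 F.2)
    exact ⟨V, hV, hV', hxy ▸ Submodule.add_mem_sup hx hy⟩
  choose V hV hV' hSV using h'
  have := hS.to_subtype
  have := FiniteDimensional.span_of_finite ℚ hS
  refine ⟨Submodule.span ℚ S ⊔ ⨆ F, V F, inferInstance, ?_,
    Submodule.mem_sup_left (Submodule.subset_span hF)⟩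
  suffices Submodule.span ℚ S ⊔ ⨆ F, V F ≤
      (Submodule.span ℚ S ⊔ ⨆ F, V F).comap (d⁄dX ℚ : ℚ⟦X⟧ →ₗ[ℚ] ℚ⟦X⟧) from this
  refine sup_le (Submodule.span_le.2 fun F hF => ?_) (iSup_le fun F v hv => ?_)
  · exact sup_le_sup_left (le_iSup V ⟨F, hF⟩) _ (hSV ⟨F, hF⟩)
  · exact Submodule.mem_sup_right (Submodule.mem_iSup_of_mem F (hV' F v hv))

/-- A system with one unknown and a purely inhomogeneous right-hand side. -/
theorem IsDerivFinite.of_derivative {F : ℚ⟦X⟧} (hF : IsDerivFinite (d⁄dX ℚ F)) :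
    IsDerivFinite F :=
  IsDerivFinite.of_system (Set.finite_singleton F)
    (fun _ hG => by rw [Set.mem_singleton_iff.1 hG]; exact Submodule.mem_sup_right hF) rfl

theorem IsDerivFinite.one : IsDerivFinite 1 :=
  .of_derivative (by rw [derivative_one]; exact .zero)

theorem IsDerivFinite.X : IsDerivFinite (PowerSeries.X : ℚ⟦X⟧) :=
  .of_derivative (by rw [derivative_X]; exact .one)

end DerivFinite

/-! ### Nested integrals. -/

section Integral

/-- The antiderivative without constant term. -/
noncomputable def integral (F : ℚ⟦X⟧) : ℚ⟦X⟧ :=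
  PowerSeries.mk fun n => if n = 0 then 0 else coeff (n - 1) F / n

@[simp]
theorem constantCoeff_integral (F : ℚ⟦X⟧) : constantCoeff (integral F) = 0 := by
  rw [← coeff_zero_eq_constantCoeff_apply, integral, coeff_mk, if_pos rfl]

@[simp]
theorem derivative_integral (F : ℚ⟦X⟧) : d⁄dX ℚ (integral F) = F := by
  ext n
  rw [coeff_derivative, integral, coeff_mk, if_neg (Nat.succ_ne_zero n), Nat.add_sub_cancel]
  push_cast
  have : (n : ℚ) + 1 ≠ 0 := by positivity
  field_simp

theorem integral_derivative {F : ℚ⟦X⟧} (h : constantCoeff F = 0) :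
    integral (d⁄dX ℚ F) = F :=
  derivative.ext (by simp) (by simp [h])

/-- The exponential generating series of shuffle forests in terms of the series of trees. -/
noncomputable def shuffleProd : {r : ℕ} → (Fin r → ℚ⟦X⟧) → ℚ⟦X⟧
  | 0, _ => 1
  | _ + 1, f => integral (d⁄dX ℚ (f 0) * shuffleProd (Fin.tail f))

theorem shuffleProd_zero (f : Fin 0 → ℚ⟦X⟧) : shuffleProd f = 1 := rfl

theorem shuffleProd_succ {r : ℕ} (f : Fin (r + 1) → ℚ⟦X⟧) :
    shuffleProd f = integral (d⁄dX ℚ (f 0) * shuffleProd (Fin.tail f)) := rfl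

theorem IsDerivFinite.shuffleProd {r : ℕ} {f : Fin r → ℚ⟦X⟧} (hf : ∀ i, IsDerivFinite (f i)) :
    IsDerivFinite (shuffleProd f) := by
  induction r with
  | zero => exact .one
  | succ r ih =>
    refine .of_derivative ?_
    rw [shuffleProd_succ, derivative_integral]
    exact (hf 0).derivative.mul (ih fun i => hf i.succ)

theorem shuffleProd_eq_zero {r : ℕ} {f : Fin r → ℚ⟦X⟧} {i : Fin r} (hi : f i = 0) :
    shuffleProd f = 0 := by
  have h0 : integral 0 = 0 := derivative.ext (by simp) (by simp)
  induction r with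
  | zero => exact i.elim0
  | succ r ih =>
    rw [shuffleProd_succ]
    cases i using Fin.cases with
    | zero => rw [hi, map_zero, zero_mul, h0]
    | succ i => rw [ih (f := Fin.tail f) hi, mul_zero, h0]

/-- Since `X' = 1`, a bare leaf contributes only one integration, and the nested integral becomes
linear in its last entry. The innermost step integrates the derivative of that entry, hence the
condition on its constant term. -/
theorem shuffleProd_eq_iterate {r : ℕ} {f : Fin (r + 1) → ℚ⟦X⟧}
    (hX : ∀ i, i ≠ Fin.last r → f i = X) (h0 : constantCoeff (f (Fin.last r)) = 0) :
    shuffleProd f = integral^[r] (f (Fin.last r)) := by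
  induction r with
  | zero =>
    rw [shuffleProd_succ, shuffleProd_zero, mul_one]
    exact integral_derivative h0
  | succ r ih =>
    rw [shuffleProd_succ, hX 0 (Fin.last_pos.ne), derivative_X, one_mul,
      Function.iterate_succ_apply', ih (f := Fin.tail f) (fun i hi => hX _ fun h => hi ?_) h0]
    · rfl
    · exact Fin.succ_injective _ h

end Integral

/-! ### Tree automata and the equations for their generating series. -/

section Automaton

open PTree

variable {Υ : Generators} {Q : Type} (q₀ : Q) (δ : ∀ μ : Υ.op, (Fin (Υ.ar μ) → Q) → Q)

/-- The state of a bottom-up tree automaton at the root of a tree. -/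
def run : PTree Υ Unit → Q
  | .leaf _ => q₀
  | .node μ c => δ μ fun i => run (c i)

theorem finite_forests (Υ : Generators) (r n : ℕ) :
    {c : Fin r → PTree Υ Unit | ∑ i, (c i).size = n}.Finite := by
  refine (Set.Finite.pi fun _ : Fin r => ((Finset.range (n + 1)).finite_toSet.biUnion
    fun m _ => finite_setOf_size_eq (Υ := Υ) m)).subset fun c hc i _ => ?_
  refine Set.mem_biUnion (x := (c i).size) ?_ rfl
  have := Finset.single_le_sum (f := fun i => (c i).size) (fun _ _ => Nat.zero_le _)
    (Finset.mem_univ i)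
  have hc : ∑ i, (c i).size = n := hc
  simp only [Finset.coe_range, Set.mem_Iio]
  omega

/-- The forests of `r` trees with `n` leaves. -/
noncomputable def forestsOfSize (Υ : Generators) (r n : ℕ) : Finset (Fin r → PTree Υ Unit) :=
  (finite_forests Υ r n).toFinset

theorem mem_forestsOfSize {r n : ℕ} {c : Fin r → PTree Υ Unit} :
    c ∈ forestsOfSize Υ r n ↔ ∑ i, (c i).size = n := by
  simp [forestsOfSize]

theorem sum_ofSize [Fintype Υ.op] (n : ℕ) (f : PTree Υ Unit → ℚ) :
    ∑ s ∈ ofSize Υ n, f s = (if n = 1 then f (.leaf ()) else 0) +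
      ∑ μ, ∑ c ∈ forestsOfSize Υ (Υ.ar μ) n, f (.node μ c) := by
  classical
  have h : ofSize Υ n = (if n = 1 then {.leaf ()} else ∅) ∪
      Finset.univ.biUnion fun μ => (forestsOfSize Υ (Υ.ar μ) n).image (PTree.node μ) := by
    ext s
    simp only [mem_ofSize, Finset.mem_union, Finset.mem_biUnion, Finset.mem_univ, true_and,
      Finset.mem_image, mem_forestsOfSize]
    cases s with
    | leaf x =>
      by_cases hn : n = 1
      · simp [hn, size]
      · simp [hn, size, Ne.symm hn]
    | node μ c =>
      constructor
      · exact fun h => Or.inr ⟨μ, c, h, rfl⟩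
      · rintro (h | ⟨ν, d, hd, he⟩)
        · split_ifs at h <;> simp at h
        · cases he
          exact hd
  rw [h, Finset.sum_union, Finset.sum_biUnion]
  · congr 1
    · split_ifs <;> simp
    · refine Finset.sum_congr rfl fun μ _ => Finset.sum_image ?_
      intro c _ d _ he
      cases he
      rfl
  · intro μ _ ν _ hμν
    refine Finset.disjoint_left.2 fun s hs hs' => hμν ?_
    obtain ⟨c, -, rfl⟩ := Finset.mem_image.1 hs
    obtain ⟨d, -, he⟩ := Finset.mem_image.1 hs'
    cases he
    rfl
  · refine Finset.disjoint_left.2 fun s hs hs' => ?_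
    obtain ⟨μ, -, hs'⟩ := Finset.mem_biUnion.1 hs'
    obtain ⟨c, -, rfl⟩ := Finset.mem_image.1 hs'
    split_ifs at hs <;> simp at hs

variable [DecidableEq Q]

/-- The exponential generating series of shuffle trees with a given state. -/
noncomputable def treeSeries (q : Q) : ℚ⟦X⟧ :=
  PowerSeries.mk fun n =>
    (∑ s ∈ (ofSize Υ n).filter fun s => run q₀ δ s = q, (numLabel s : ℚ)) / n.factorial

/-- The exponential generating series of shuffle forests with given states. -/
noncomputable def forestSeries {r : ℕ} (x : Fin r → Q) : ℚ⟦X⟧ :=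
  PowerSeries.mk fun n =>
    (∑ c ∈ (forestsOfSize Υ r n).filter fun c => (fun i => run q₀ δ (c i)) = x,
      (forestNum c : ℚ)) / n.factorial

theorem constantCoeff_treeSeries (q : Q) : constantCoeff (treeSeries q₀ δ q) = 0 := by
  have : ofSize Υ 0 = ∅ := Finset.eq_empty_of_forall_notMem fun s hs =>
    (size_pos s).ne' (mem_ofSize.1 hs)
  rw [← coeff_zero_eq_constantCoeff_apply, treeSeries, coeff_mk]
  simp [this]

/-- The binomial coefficient for the first tree is `(i + j).choose i`, as in a product of
exponential series. The tree has `i + 1` leaves but one label is forced, which is why its series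
enters through its derivative. -/
theorem forestNum_cons_div (s : PTree Υ Unit) {r : ℕ} (c : Fin r → PTree Υ Unit) {i j : ℕ}
    (hs : s.size = i + 1) (hc : ∑ l, (c l).size = j) :
    (forestNum (Fin.cons s c : Fin (r + 1) → PTree Υ Unit) : ℚ) / (i + j).factorial =
      numLabel s * forestNum c / (i.factorial * j.factorial) := by
  rw [forestNum_succ, Fin.sum_univ_succ]
  simp only [Fin.cons_zero, Fin.cons_succ, Fin.tail_cons, hs, hc]
  rw [show i + 1 + j - 1 = i + j by omega, Nat.add_sub_cancel]
  push_cast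
  rw [Nat.cast_add_choose]
  have h1 : ((i + j).factorial : ℚ) ≠ 0 := by positivity
  field_simp

/-- This is the `n`-th coefficient of the identity: the derivative of the forest series equals the
derivative of the first tree's series times the series of the remaining forest. -/
theorem sum_forests_cons {r : ℕ} (x : Fin (r + 1) → Q) (n : ℕ) :
    (∑ c ∈ (forestsOfSize Υ (r + 1) (n + 1)).filter fun c => (fun i => run q₀ δ (c i)) = x,
      (forestNum c : ℚ)) / (n + 1).factorial * ((n : ℚ) + 1) =
    ∑ p ∈ Finset.HasAntidiagonal.antidiagonal n,
      (∑ s ∈ (ofSize Υ (p.1 + 1)).filter fun s => run q₀ δ s = x 0, (numLabel s : ℚ)) /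
        (p.1 + 1).factorial * ((p.1 : ℚ) + 1) *
      ((∑ c ∈ (forestsOfSize Υ r p.2).filter fun c => (fun i => run q₀ δ (c i)) = Fin.tail x,
        (forestNum c : ℚ)) / p.2.factorial) := by
  -- The factor from differentiation cancels against the factorial, on both sides.
  have hfac : ∀ (a : ℚ) (m : ℕ), a / (m + 1).factorial * ((m : ℚ) + 1) = a / m.factorial := by
    intro a m
    rw [Nat.factorial_succ]
    have : (m : ℚ) + 1 ≠ 0 := by positivity
    push_cast
    field_simp
  simp only [hfac]
  simp only [div_mul_div_comm, Finset.sum_mul_sum, ← Finset.sum_product']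
  simp only [Finset.sum_div]
  rw [Finset.sum_sigma']
  symm
  refine Finset.sum_bij' (fun y _ => (Fin.cons y.2.1 y.2.2 : Fin (r + 1) → PTree Υ Unit))
    (fun c _ => ⟨((c 0).size - 1, ∑ i, (Fin.tail c i).size), (c 0, Fin.tail c)⟩) ?_ ?_ ?_ ?_ ?_
  · rintro ⟨⟨i, j⟩, s, c⟩ hy
    simp only [Finset.mem_sigma, Finset.HasAntidiagonal.mem_antidiagonal, Finset.mem_product, Finset.mem_filter,
      mem_ofSize, mem_forestsOfSize] at hy ⊢
    obtain ⟨hij, ⟨hs, hs'⟩, hc, hc'⟩ := hy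
    refine ⟨?_, funext fun l => ?_⟩
    · simp only [Fin.sum_univ_succ, Fin.cons_zero, Fin.cons_succ]
      omega
    · cases l using Fin.cases with
      | zero => exact hs'
      | succ l => exact congrFun hc' l
  · intro c hc
    simp only [Finset.mem_sigma, Finset.HasAntidiagonal.mem_antidiagonal, Finset.mem_product, Finset.mem_filter,
      mem_ofSize, mem_forestsOfSize] at hc ⊢
    obtain ⟨hc, rfl⟩ := hc
    have := size_pos (c 0)
    rw [Fin.sum_univ_succ] at hc
    refine ⟨?_, ⟨by omega, rfl⟩, trivial, rfl⟩
    change (c 0).size - 1 + ∑ i : Fin r, (c i.succ).size = n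
    omega
  · rintro ⟨⟨i, j⟩, s, c⟩ hy
    simp only [Finset.mem_sigma, Finset.HasAntidiagonal.mem_antidiagonal, Finset.mem_product, Finset.mem_filter,
      mem_ofSize, mem_forestsOfSize] at hy
    obtain ⟨hij, ⟨hs, hs'⟩, hc, hc'⟩ := hy
    simp [hs, hc]
  · intro c _
    exact Fin.cons_self_tail c
  · rintro ⟨⟨i, j⟩, s, c⟩ hy
    simp only [Finset.mem_sigma, Finset.HasAntidiagonal.mem_antidiagonal, Finset.mem_product, Finset.mem_filter,
      mem_ofSize, mem_forestsOfSize] at hy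
    obtain ⟨rfl, ⟨hs, hs'⟩, hc, hc'⟩ := hy
    exact (forestNum_cons_div s c hs hc).symm

/-- For a nonempty forest both sides have constant term zero, and their derivatives agree by
splitting off the first tree. -/
theorem forestSeries_eq_shuffleProd {r : ℕ} (x : Fin r → Q) :
    forestSeries q₀ δ x = shuffleProd fun i => treeSeries q₀ δ (x i) := by
  induction r with
  | zero =>
    ext n
    rw [forestSeries, coeff_mk, shuffleProd_zero, coeff_one]
    by_cases hn : n = 0
    · subst hn
      have : (forestsOfSize Υ 0 0).filter (fun c => (fun i => run q₀ δ (c i)) = x) =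
          {Fin.elim0} := by
        ext c
        simp [mem_forestsOfSize, eq_iff_true_of_subsingleton]
      simp [this, forestNum, shuffleCoeff]
    · have : forestsOfSize Υ 0 n = ∅ := Finset.eq_empty_of_forall_notMem fun c hc => by
        have := mem_forestsOfSize.1 hc
        simp [Ne.symm hn] at this
      simp [this, hn]
  | succ r ih =>
    refine derivative.ext ?_ ?_
    · rw [shuffleProd_succ, derivative_integral]
      have ih' := ih (Fin.tail x)
      change _ = shuffleProd (Fin.tail fun i => treeSeries q₀ δ (x i)) at ih'
      rw [← ih']
      ext n
      rw [coeff_derivative, coeff_mul, forestSeries, coeff_mk]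
      simp only [coeff_derivative, treeSeries, forestSeries, coeff_mk]
      exact sum_forests_cons q₀ δ x n
    · rw [shuffleProd_succ, constantCoeff_integral]
      have : forestsOfSize Υ (r + 1) 0 = ∅ := Finset.eq_empty_of_forall_notMem fun c hc => by
        have := mem_forestsOfSize.1 hc
        rw [Fin.sum_univ_succ] at this
        have := size_pos (c 0)
        omega
      rw [← coeff_zero_eq_constantCoeff_apply, forestSeries, coeff_mk]
      simp [this]

/-- A tree is a leaf or a root vertex with a forest; the forests are sorted by the states of their
trees. -/
theorem treeSeries_eq [Fintype Υ.op] [Fintype Q] (q : Q) :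
    treeSeries q₀ δ q = (if q₀ = q then X else 0) +
      ∑ μ : Υ.op, ∑ x : Fin (Υ.ar μ) → Q with δ μ x = q,
        shuffleProd fun i => treeSeries q₀ δ (x i) := by
  ext n
  rw [treeSeries, coeff_mk, Finset.sum_filter, sum_ofSize, map_add, map_sum, add_div,
    Finset.sum_div]
  congr 1
  · by_cases hq : q₀ = q <;> by_cases hn : n = 1 <;> simp [hq, hn, run, numLabel, coeff_X]
  · refine Finset.sum_congr rfl fun μ _ => ?_
    rw [map_sum, ← Finset.sum_filter]
    simp only [← forestSeries_eq_shuffleProd, forestSeries, coeff_mk]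
    rw [← Finset.sum_div]
    congr 1
    rw [← Finset.sum_fiberwise_of_maps_to (g := fun c : Fin (Υ.ar μ) → PTree Υ Unit =>
      fun i => run q₀ δ (c i)) (t := Finset.univ.filter fun x => δ μ x = q)]
    · refine Finset.sum_congr rfl fun x hx => Finset.sum_congr ?_ fun c _ => by
        rw [numLabel_node]
      rw [Finset.filter_filter]
      refine Finset.filter_congr fun c _ => ⟨fun h => h.2, fun h => ⟨?_, h⟩⟩
      simp only [run, h]
      exact (Finset.mem_filter.1 hx).2
    · intro c hc
      exact Finset.mem_filter.2 ⟨Finset.mem_univ _, (Finset.mem_filter.1 hc).2⟩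

end Automaton

end ShOp

/-! ### Factorial lower bounds from expanding cycles. -/

namespace ShOp

open PowerSeries

section LowerBound

open PTree

variable {Υ : Generators}

theorem le_tail_sum {r : ℕ} (n : Fin r → ℕ) (i : Fin r) :
    n i ≤ ∑ j, if i ≤ j then n j else 0 :=
  (le_of_eq (by simp)).trans (Finset.single_le_sum (f := fun j => if i ≤ j then n j else 0)
    (fun _ _ => Nat.zero_le _) (Finset.mem_univ i))

theorem add_le_tail_sum {r : ℕ} (n : Fin r → ℕ) {i j : Fin r} (h : i < j) :
    n i + n j ≤ ∑ l, if i ≤ l then n l else 0 := by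
  calc n i + n j = ∑ l ∈ {i, j}, if i ≤ l then n l else 0 := by
        rw [Finset.sum_pair h.ne]; simp [h.le]
    _ ≤ _ := Finset.sum_le_sum_of_subset (Finset.subset_univ _)

theorem shuffleCoeff_pos {r : ℕ} (n : Fin r → ℕ) : 0 < shuffleCoeff n :=
  Finset.prod_pos fun i _ => Nat.choose_pos (Nat.sub_le_sub_right (le_tail_sum n i) 1)

theorem numLabel_pos (s : PTree Υ Unit) : 0 < numLabel s := by
  induction s with
  | leaf x => exact Nat.one_pos
  | node μ c ih => exact Nat.mul_pos (shuffleCoeff_pos _) (Finset.prod_pos fun i _ => ih i)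

/-- All factors of the count are positive integers, so any one binomial and any one child may be
kept and the rest discarded. -/
theorem choose_mul_le_numLabel {μ : Υ.op} (c : Fin (Υ.ar μ) → PTree Υ Unit)
    (i j : Fin (Υ.ar μ)) :
    ((∑ l, if j ≤ l then (c l).size else 0) - 1).choose ((c j).size - 1) * numLabel (c i) ≤
      numLabel (.node μ c) :=
  Nat.mul_le_mul
    (Nat.le_of_dvd (shuffleCoeff_pos _) (Finset.dvd_prod_of_mem _ (Finset.mem_univ j)))
    (Nat.le_of_dvd (Finset.prod_pos fun _ _ => numLabel_pos _)
      (Finset.dvd_prod_of_mem _ (Finset.mem_univ i)))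

theorem numLabel_child_le {μ : Υ.op} (c : Fin (Υ.ar μ) → PTree Υ Unit) (i : Fin (Υ.ar μ)) :
    numLabel (c i) ≤ numLabel (.node μ c) :=
  (Nat.le_mul_of_pos_left _ (Nat.choose_pos (Nat.sub_le_sub_right
    (le_tail_sum (fun l => (c l).size) i) 1))).trans (choose_mul_le_numLabel c i i)

/-- One binomial factor is at least `(c i).size`. If `i` is not last, its own factor suffices, since
a later sibling supplies an extra leaf. If `i` is last, the factor of an earlier sibling `j` with
two leaves does, already exceeding `(c i).size` when `j` has exactly two. -/
theorem size_mul_numLabel_child_le {μ : Υ.op} (c : Fin (Υ.ar μ) → PTree Υ Unit)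
    (i : Fin (Υ.ar μ)) (h : (i : ℕ) + 1 ≠ Υ.ar μ ∨ ∃ j, j ≠ i ∧ 2 ≤ (c j).size) :
    (c i).size * numLabel (c i) ≤ numLabel (.node μ c) := by
  have h1 : (i : ℕ) + 1 ≠ Υ.ar μ → (c i).size * numLabel (c i) ≤ numLabel (.node μ c) := by
    intro h
    have hlt : (i : ℕ) + 1 < Υ.ar μ := lt_of_le_of_ne i.2 h
    refine le_trans (Nat.mul_le_mul_right _ ?_) (choose_mul_le_numLabel c i i)
    have h2 := add_le_tail_sum (fun l => (c l).size) (i := i) (j := ⟨i + 1, hlt⟩)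
      (Fin.lt_def.2 (Nat.lt_succ_self _))
    have h3 := size_pos (c ⟨i + 1, hlt⟩)
    have h4 := size_pos (c i)
    calc (c i).size = (c i).size.choose ((c i).size - 1) := by
          obtain ⟨m, hm⟩ := Nat.exists_eq_add_of_lt h4
          rw [hm]; simp
      _ ≤ _ := Nat.choose_le_choose _ (by omega)
  by_cases hi : (i : ℕ) + 1 = Υ.ar μ
  · obtain ⟨j, hj, hj2⟩ := h.resolve_left (not_not.2 hi)
    refine le_trans (Nat.mul_le_mul_right _ ?_) (choose_mul_le_numLabel c i j)
    have hlt : j < i := lt_of_le_of_ne (Fin.le_def.2 (by have := j.2; omega)) hj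
    have h2 := add_le_tail_sum (fun l => (c l).size) hlt
    have h4 := size_pos (c i)
    calc (c i).size ≤ ((c i).size - 1 + 1 + 1).choose ((c i).size - 1 + 1) := by
          rw [Nat.choose_succ_self_right]; omega
      _ ≤ ((c i).size + ((c j).size - 1)).choose (c i).size := by
          rw [Nat.sub_add_cancel h4]
          exact Nat.choose_le_choose _ (by omega)
      _ = ((c i).size + ((c j).size - 1)).choose ((c j).size - 1) := Nat.choose_symm_add
      _ ≤ _ := Nat.choose_le_choose _ (by omega)
  · exact h1 hi

theorem size_update {μ : Υ.op} (c : Fin (Υ.ar μ) → PTree Υ Unit) (i : Fin (Υ.ar μ)) :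
    ∃ l, 0 < l ∧ ∀ t, (PTree.node μ (Function.update c i t)).size = t.size + l := by
  refine ⟨∑ j ∈ Finset.univ.erase i, (c j).size, ?_, fun t => ?_⟩
  · refine Finset.sum_pos (fun j _ => size_pos _) ?_
    have : Nontrivial (Fin (Υ.ar μ)) := Fin.nontrivial_iff_two_le.2 (Υ.two_le μ)
    obtain ⟨j, hj⟩ := exists_ne i
    exact ⟨j, Finset.mem_erase.2 ⟨hj, Finset.mem_univ _⟩⟩
  · rw [size, ← Finset.add_sum_erase _ _ (Finset.mem_univ i), Function.update_self]
    congr 1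
    refine Finset.sum_congr rfl fun j hj => ?_
    rw [Function.update_of_ne (Finset.ne_of_mem_erase hj)]

variable {Q : Type} (q₀ : Q) (δ : ∀ μ : Υ.op, (Fin (Υ.ar μ) → Q) → Q)

/-- `q'` is the state of a child of a vertex with state `q` in some tree. -/
def Step (q q' : Q) : Prop :=
  ∃ (μ : Υ.op) (x : Fin (Υ.ar μ) → Q) (i : Fin (Υ.ar μ)),
    δ μ x = q ∧ x i = q' ∧ ∀ j, ∃ s, run q₀ δ s = x j

/-- There is a tree with one hole that has state `q` when the hole is filled with a tree of
state `q'`. -/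
def HasContext (q q' : Q) : Prop :=
  ∃ (l : ℕ) (T : PTree Υ Unit → PTree Υ Unit), ∀ t, run q₀ δ t = q' →
    run q₀ δ (T t) = q ∧ (T t).size = t.size + l ∧ numLabel t ≤ numLabel (T t)

theorem run_update {μ : Υ.op} {x : Fin (Υ.ar μ) → Q} {c : Fin (Υ.ar μ) → PTree Υ Unit}
    (hc : ∀ j, run q₀ δ (c j) = x j) {i : Fin (Υ.ar μ)} {t : PTree Υ Unit}
    (ht : run q₀ δ t = x i) : run q₀ δ (.node μ (Function.update c i t)) = δ μ x := by
  rw [run]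
  congr 1
  funext j
  by_cases hj : j = i
  · subst hj; rwa [Function.update_self]
  · rw [Function.update_of_ne hj, hc]

/-- One-vertex contexts are composed along the path. The siblings of the hole are fixed trees of the
required states, which exist because `Step` asks for them. -/
theorem HasContext.of_reflTransGen {q q' : Q}
    (h : Relation.ReflTransGen (Step q₀ δ) q q') : HasContext q₀ δ q q' := by
  induction h with
  | refl => exact ⟨0, id, fun t ht => ⟨ht, rfl, le_rfl⟩⟩
  | tail _ h ih =>
    obtain ⟨l, T, hT⟩ := ih
    obtain ⟨μ, x, i, rfl, rfl, hx⟩ := h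
    choose c hc using hx
    obtain ⟨l', -, hl'⟩ := size_update c i
    refine ⟨l' + l, fun t => T (.node μ (Function.update c i t)), fun t ht => ?_⟩
    obtain ⟨h1, h2, h3⟩ := hT _ (run_update q₀ δ hc ht)
    refine ⟨h1, by rw [h2, hl', add_assoc], le_trans ?_ h3⟩
    simpa using numLabel_child_le (Function.update c i t) i

/-- A cyclic chain of steps with a vertex that either continues into a non-last input, or has
another input that admits more than one leaf, gives a context that multiplies the number of
labellings. -/
theorem exists_expanding_context {μ : Υ.op} {x : Fin (Υ.ar μ) → Q} (i : Fin (Υ.ar μ))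
    (hx : ∀ j, ∃ s, run q₀ δ s = x j)
    (hcyc : Relation.ReflTransGen (Step q₀ δ) (x i) (δ μ x))
    (hbad : (i : ℕ) + 1 ≠ Υ.ar μ ∨ ∃ j, j ≠ i ∧ ∃ s, run q₀ δ s = x j ∧ 2 ≤ s.size) :
    ∃ l, 0 < l ∧ ∃ T : PTree Υ Unit → PTree Υ Unit, ∀ t, run q₀ δ t = x i →
      run q₀ δ (T t) = x i ∧ (T t).size = t.size + l ∧ t.size * numLabel t ≤ numLabel (T t) := by
  -- The siblings are chosen so that the offending one really has two leaves.
  obtain ⟨c, hc, hc'⟩ : ∃ c : Fin (Υ.ar μ) → PTree Υ Unit, (∀ j, run q₀ δ (c j) = x j) ∧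
      ((i : ℕ) + 1 ≠ Υ.ar μ ∨ ∃ j, j ≠ i ∧ 2 ≤ (c j).size) := by
    choose c hc using hx
    rcases hbad with h | ⟨j, hj, s, hs, hs2⟩
    · exact ⟨c, hc, Or.inl h⟩
    · refine ⟨Function.update c j s, fun l => ?_, Or.inr ⟨j, hj, by simpa using hs2⟩⟩
      by_cases hl : l = j
      · subst hl; rwa [Function.update_self]
      · rw [Function.update_of_ne hl, hc]
  obtain ⟨l', hl', hsize⟩ := size_update c i
  -- This context closes the cycle, leading from the state `δ μ x` of the new vertex back to `x i`.
  obtain ⟨l, T, hT⟩ := HasContext.of_reflTransGen q₀ δ hcyc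
  refine ⟨l' + l, by omega, fun t => T (.node μ (Function.update c i t)), fun t ht => ?_⟩
  obtain ⟨h1, h2, h3⟩ := hT _ (run_update q₀ δ hc ht)
  refine ⟨h1, by rw [h2, hsize, add_assoc], le_trans ?_ h3⟩
  have := size_mul_numLabel_child_le (Function.update c i t) i <| hc'.imp_right
    fun ⟨j, hj, hj2⟩ => ⟨j, hj, by rwa [Function.update_of_ne hj]⟩
  simpa using this

/-- With `K = n₀ + l`, the index `n₀ + m * l` is at most `m * K` for `m ≥ 1`. The parameters `A = K`
and `B = 2 * K` therefore bound `m!` by `C * √m ^ m`, against `m! ≥ (m / e) ^ m`. The contradiction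
appears once `√m ≥ 2 * e` and `2 ^ m > C`. -/
theorem not_subfactorial_of_factorial_le {a : ℕ → ℕ} {n₀ l : ℕ} (hl : 0 < l)
    (h : ∀ m, m.factorial ≤ a (n₀ + m * l)) : ¬ Subfactorial a := by
  intro hsub
  have hK : (0 : ℝ) < n₀ + l := by positivity
  obtain ⟨C, hC, hev⟩ := hsub (n₀ + l) (2 * (n₀ + l)) hK (by positivity)
  have htend : Filter.Tendsto (fun m => n₀ + m * l) Filter.atTop Filter.atTop :=
    Filter.tendsto_atTop_mono (fun m => (Nat.le_mul_of_pos_right m hl).trans (Nat.le_add_left _ _)) Filter.tendsto_id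
  have hev2 : ∀ᶠ m : ℕ in Filter.atTop, C < 2 ^ m :=
    (tendsto_pow_atTop_atTop_of_one_lt (one_lt_two : (1 : ℝ) < 2)).eventually_gt_atTop C
  obtain ⟨m, hm1, hm2, hm3⟩ := ((htend.eventually hev).and (hev2.and
    (Filter.eventually_ge_atTop (Nat.ceil ((2 * Real.exp 1) ^ 2))))).exists
  have hm3 : (2 * Real.exp 1) ^ 2 ≤ m := Nat.ceil_le.1 hm3
  have he : 2 * Real.exp 1 ≤ √m := Real.le_sqrt_of_sq_le hm3
  have hmge : (1 : ℝ) ≤ m := by nlinarith [Real.add_one_le_exp (1 : ℝ)]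
  have hn : ((n₀ + m * l : ℕ) : ℝ) ≤ m * (n₀ + l) := by
    push_cast
    nlinarith [mul_nonneg (sub_nonneg.2 hmge) (Nat.cast_nonneg (α := ℝ) n₀)]
  have h1 : (((n₀ + m * l : ℕ) : ℝ) / (n₀ + l)) ^ (((n₀ + m * l : ℕ) : ℝ) / (2 * (n₀ + l))) ≤
      √m ^ m := by
    have e1 : ((n₀ + m * l : ℕ) : ℝ) / (n₀ + l) ≤ m := by rwa [div_le_iff₀ hK]
    have e2 : ((n₀ + m * l : ℕ) : ℝ) / (2 * (n₀ + l)) ≤ 1 / 2 * m := by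
      rw [div_le_iff₀ (by positivity)]; linarith
    refine (Real.rpow_le_rpow (by positivity) e1 (by positivity)).trans ?_
    refine (Real.rpow_le_rpow_of_exponent_le hmge e2).trans (le_of_eq ?_)
    rw [Real.rpow_mul (by positivity), ← Real.sqrt_eq_rpow, Real.rpow_natCast]
  have h2 : (m : ℝ) ^ m / m.factorial ≤ Real.exp 1 ^ m := by
    rw [← Real.exp_nat_mul, mul_one]
    exact Real.pow_div_factorial_le_exp _ (by positivity) _
  have h3 : (m.factorial : ℝ) < C * √m ^ m :=
    lt_of_le_of_lt (Nat.cast_le.2 (h m)) (hm1.trans_le (mul_le_mul_of_nonneg_left h1 hC.le))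
  rw [div_le_iff₀ (by positivity)] at h2
  have h4 : (m : ℝ) ^ m = √m ^ m * √m ^ m := by
    rw [← mul_pow, Real.mul_self_sqrt (by positivity)]
  have h5 : (2 : ℝ) ^ m * Real.exp 1 ^ m ≤ √m ^ m := by
    rw [← mul_pow]
    exact pow_le_pow_left₀ (by positivity) he m
  have hs : 0 < √(m : ℝ) ^ m := by positivity
  have hx : 0 < Real.exp 1 ^ m := by positivity
  have h6 : √(m : ℝ) ^ m * √m ^ m < Real.exp 1 ^ m * (C * √m ^ m) :=
    (h4 ▸ h2).trans_lt (mul_lt_mul_of_pos_left h3 hx)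
  have h7 : √(m : ℝ) ^ m < Real.exp 1 ^ m * C := by
    refine lt_of_mul_lt_mul_right ?_ hs.le
    linarith
  nlinarith

/-- After `m` iterations the tree has at least `m + 1` leaves, so the next one multiplies the number
of labellings by at least `m + 1`. -/
theorem not_subfactorial_of_expanding {a : ℕ → ℕ} {q : Q} {t₀ : PTree Υ Unit}
    (ht₀ : run q₀ δ t₀ = q) (ha : ∀ t, run q₀ δ t = q → numLabel t ≤ a t.size) {l : ℕ}
    (hl : 0 < l) {T : PTree Υ Unit → PTree Υ Unit}
    (hT : ∀ t, run q₀ δ t = q →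
      run q₀ δ (T t) = q ∧ (T t).size = t.size + l ∧ t.size * numLabel t ≤ numLabel (T t)) :
    ¬ Subfactorial a := by
  have key : ∀ m, run q₀ δ (T^[m] t₀) = q ∧ (T^[m] t₀).size = t₀.size + m * l ∧
      m.factorial ≤ numLabel (T^[m] t₀) := by
    intro m
    induction m with
    | zero => exact ⟨ht₀, by simp, numLabel_pos _⟩
    | succ m ih =>
      obtain ⟨h1, h2, h3⟩ := ih
      obtain ⟨h4, h5, h6⟩ := hT _ h1
      rw [Function.iterate_succ_apply']
      refine ⟨h4, by rw [h5, h2]; ring, le_trans ?_ h6⟩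
      rw [Nat.factorial_succ]
      refine Nat.mul_le_mul ?_ h3
      rw [h2]
      have := size_pos t₀
      nlinarith
  refine not_subfactorial_of_factorial_le (n₀ := t₀.size) hl fun m => ?_
  obtain ⟨h1, h2, h3⟩ := key m
  rw [← h2]
  exact h3.trans (ha _ h1)

end LowerBound

end ShOp

/-! ### Linear systems over the strongly connected components of the automaton. -/

namespace ShOp

open PowerSeries

section Rationality

open PTree

variable {Υ : Generators} {Q : Type} [DecidableEq Q] (q₀ : Q)
  (δ : ∀ μ : Υ.op, (Fin (Υ.ar μ) → Q) → Q)

theorem eq_leaf_of_size_lt_two {t : PTree Υ Unit} (h : t.size < 2) : t = .leaf () := by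
  cases t with
  | leaf x => rfl
  | node μ c =>
    have h1 := size_child_lt c ⟨0, by have := Υ.two_le μ; omega⟩
    have h2 := size_pos (c ⟨0, by have := Υ.two_le μ; omega⟩)
    omega

theorem treeSeries_eq_X {q : Q} (hq : ∃ s, run q₀ δ s = q)
    (h : ∀ s, run q₀ δ s = q → s.size < 2) : treeSeries q₀ δ q = X := by
  obtain ⟨s, hs⟩ := hq
  obtain rfl := eq_leaf_of_size_lt_two (h s hs)
  ext n
  rw [treeSeries, coeff_mk, coeff_X]
  by_cases hn : n = 1
  · subst hn
    have : (ofSize Υ 1).filter (fun s => run q₀ δ s = q) = {.leaf ()} := by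
      ext t
      simp only [Finset.mem_filter, mem_ofSize, Finset.mem_singleton]
      exact ⟨fun ht => eq_leaf_of_size_lt_two (by omega), fun ht => by subst ht; exact ⟨rfl, hs⟩⟩
    simp [this, numLabel]
  · have : (ofSize Υ n).filter (fun s => run q₀ δ s = q) = ∅ := by
      refine Finset.filter_eq_empty_iff.2 fun t ht ht' => hn ?_
      rw [← mem_ofSize.1 ht, eq_leaf_of_size_lt_two (h t ht')]
      rfl
    simp [this, hn]

theorem treeSeries_eq_zero {q : Q} (hq : ¬ ∃ s, run q₀ δ s = q) : treeSeries q₀ δ q = 0 := by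
  ext n
  have : (ofSize Υ n).filter (fun s => run q₀ δ s = q) = ∅ :=
    Finset.filter_eq_empty_iff.2 fun t _ ht' => hq ⟨t, ht'⟩
  simp [treeSeries, this]

theorem shuffleProd_eq_iterate' {r : ℕ} {f : Fin r → ℚ⟦X⟧} {i : Fin r} (hi : (i : ℕ) + 1 = r)
    (hX : ∀ j, j ≠ i → f j = X) (h0 : constantCoeff (f i) = 0) :
    shuffleProd f = integral^[r - 1] (f i) := by
  cases r with
  | zero => exact i.elim0
  | succ r =>
    obtain rfl : i = Fin.last r := Fin.ext (by simpa using hi)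
    exact shuffleProd_eq_iterate hX h0

variable [Fintype Q] {q₀ δ}

/-- Under subfactorial growth, the exponential generating series of the trees with a given live
state satisfies a linear differential equation with constant coefficients. -/
theorem isDerivFinite_treeSeries {Live : Q → Prop}
    (hLive : ∀ (μ : Υ.op) (x : Fin (Υ.ar μ) → Q), Live (δ μ x) → ∀ i, Live (x i))
    {a : ℕ → ℕ} (hsub : Subfactorial a)
    (ha : ∀ t, Live (run q₀ δ t) → numLabel t ≤ a t.size) {q : Q} (hq : Live q) :
    IsDerivFinite (treeSeries q₀ δ q) := by
  have := Υ.finite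
  have := Fintype.ofFinite Υ.op
  let Reach := Relation.ReflTransGen (Step q₀ δ)
  -- The induction runs over strongly connected components, from those reached last upwards.
  have hwf : WellFounded (fun p q => Reach q p ∧ ¬ Reach p q) := by
    have : IsTrans Q (fun p q => Reach q p ∧ ¬ Reach p q) :=
      ⟨fun p q r h h' => ⟨h'.1.trans h.1, fun h'' => h.2 (h''.trans h'.1)⟩⟩
    have : Std.Irrefl (fun p q => Reach q p ∧ ¬ Reach p q) := ⟨fun p h => h.2 h.1⟩
    exact Finite.wellFounded_of_trans_of_irrefl _
  have hlive : ∀ {p q}, Reach p q → Live p → Live q := by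
    intro p q h hp
    induction h with
    | refl => exact hp
    | tail _ h ih =>
      obtain ⟨μ, x, i, rfl, rfl, -⟩ := h
      exact hLive μ x ih i
  obtain ⟨R, hR⟩ : ∃ R, ∀ μ, Υ.ar μ ≤ R :=
    ⟨∑ μ, Υ.ar μ, fun μ => Finset.single_le_sum (fun _ _ => Nat.zero_le _) (Finset.mem_univ μ)⟩
  induction q using hwf.induction with
  | _ q ih =>
    -- The unknowns are the series of one component together with their iterated integrals. The
    -- bound `R` on arities keeps the system finite while covering every integral that a vertex can
    -- produce.
    let S : Set ℚ⟦X⟧ := (fun y : ℕ × Q => integral^[y.1] (treeSeries q₀ δ y.2)) ''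
      (Set.Iio (R + 1) ×ˢ {p | Reach q p ∧ Reach p q})
    have hS : S.Finite := ((Set.finite_Iio _).prod (Set.toFinite _)).image _
    refine IsDerivFinite.of_system hS ?_ (F := treeSeries q₀ δ q)
      ⟨(0, q), ⟨Nat.succ_pos R, .refl, .refl⟩, rfl⟩
    rintro _ ⟨⟨k, p⟩, ⟨hk, hqp, hpq⟩, rfl⟩
    dsimp only at hqp hpq hk ⊢
    rw [Set.mem_Iio] at hk
    cases k with
    | succ k =>
      rw [Function.iterate_succ_apply', derivative_integral]
      refine Submodule.mem_sup_left (Submodule.subset_span ⟨(k, p), ⟨?_, hqp, hpq⟩, rfl⟩)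
      exact Nat.lt_of_succ_lt hk
    | zero =>
      rw [Function.iterate_zero, id, treeSeries_eq, map_add, map_sum]
      refine Submodule.add_mem _ (Submodule.mem_sup_right ?_) (Submodule.sum_mem _ fun μ _ => ?_)
      · split_ifs
        · exact IsDerivFinite.X.derivative
        · exact IsDerivFinite.zero.derivative
      rw [map_sum]
      refine Submodule.sum_mem _ fun x hx => ?_
      have hx : δ μ x = p := (Finset.mem_filter.1 hx).2
      -- A transition with a state that no tree attains contributes zero; otherwise all its inputs
      -- are genuine steps.
      by_cases hinh : ∀ j, ∃ s, run q₀ δ s = x j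
      swap
      · push Not at hinh
        obtain ⟨j, hj⟩ := hinh
        rw [shuffleProd_eq_zero (i := j) (treeSeries_eq_zero q₀ δ (by simpa using hj)), map_zero]
        exact Submodule.zero_mem _
      have hstep : ∀ i, Reach p (x i) := fun i => .single ⟨μ, x, i, hx, rfl, hinh⟩
      -- If no input returns to the component, the term is inhomogeneous and the induction
      -- hypothesis covers all its factors.
      by_cases hlow : ∀ i, ¬ Reach (x i) p
      · refine Submodule.mem_sup_right (IsDerivFinite.shuffleProd fun i => ?_).derivative
        exact ih (x i) ⟨hqp.trans (hstep i), fun h => hlow i (h.trans hqp)⟩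
          (hlive (hqp.trans (hstep i)) hq)
      push Not at hlow
      obtain ⟨i, hi⟩ := hlow
      -- An input that returns closes a cycle, which must not be expanding.
      have hgood : ¬ ((i : ℕ) + 1 ≠ Υ.ar μ ∨ ∃ j, j ≠ i ∧ ∃ s, run q₀ δ s = x j ∧ 2 ≤ s.size) := by
        intro hbad
        obtain ⟨l, hl, T, hT⟩ := exists_expanding_context q₀ δ i hinh (by rw [hx]; exact hi) hbad
        obtain ⟨t₀, ht₀⟩ := hinh i
        refine not_subfactorial_of_expanding q₀ δ ht₀ (fun t ht => ha t ?_) hl hT hsub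
        rw [ht]
        exact hlive (hqp.trans (hstep i)) hq
      push Not at hgood
      obtain ⟨hlast, hsmall⟩ := hgood
      rw [shuffleProd_eq_iterate' hlast
        (fun j hj => treeSeries_eq_X q₀ δ (hinh j) (hsmall j hj)) (constantCoeff_treeSeries _ _ _)]
      have h2 := Υ.two_le μ
      have h3 := hR μ
      -- Differentiation removes one of the `Υ.ar μ - 1` integrations; there is one to remove
      -- because the arity is at least two.
      rw [show Υ.ar μ - 1 = (Υ.ar μ - 2) + 1 by omega, Function.iterate_succ_apply',
        derivative_integral]
      refine Submodule.mem_sup_left (Submodule.subset_span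
        ⟨(Υ.ar μ - 2, x i), ⟨?_, hqp.trans (hstep i), hi.trans hpq⟩, rfl⟩)
      rw [Set.mem_Iio]
      omega

theorem isDerivFinite_expSeries_of_automaton {Live : Q → Prop}
    (hLive : ∀ (μ : Υ.op) (x : Fin (Υ.ar μ) → Q), Live (δ μ x) → ∀ i, Live (x i))
    {a : ℕ → ℕ} (hsub : Subfactorial a) [DecidablePred Live]
    (ha : ∀ n, a n = ∑ s ∈ (ofSize Υ n).filter fun s => Live (run q₀ δ s), numLabel s) :
    IsDerivFinite (expSeries a) := by
  have h : expSeries a = ∑ q with Live q, treeSeries q₀ δ q := by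
    ext n
    rw [expSeries, coeff_mk, map_sum]
    simp only [treeSeries, coeff_mk]
    rw [← Finset.sum_div]
    have h1 : (a n : ℚ) = ∑ q with Live q,
        ∑ s ∈ (ofSize Υ n).filter fun s => run q₀ δ s = q, (numLabel s : ℚ) := by
      rw [ha n, Nat.cast_sum, ← Finset.sum_fiberwise_of_maps_to (g := run q₀ δ)
        (t := Finset.univ.filter Live) fun s hs => Finset.mem_filter.2
          ⟨Finset.mem_univ _, (Finset.mem_filter.1 hs).2⟩]
      refine Finset.sum_congr rfl fun q hq => Finset.sum_congr ?_ fun _ _ => rfl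
      rw [Finset.filter_filter]
      refine Finset.filter_congr fun s _ => ⟨fun h => h.2, fun h => ⟨?_, h⟩⟩
      rw [h]
      exact (Finset.mem_filter.1 hq).2
    rw [← h1]
    split_ifs with hn
    -- No tree has zero leaves, so dropping the constant term loses nothing.
    · have h0 : ofSize Υ 0 = ∅ := Finset.eq_empty_of_forall_notMem fun s hs =>
        (size_pos s).ne' (mem_ofSize.1 hs)
      simp [hn, ha 0, h0]
    · rfl
  rw [h, ← mem_derivFinite]
  refine Submodule.sum_mem _ fun q hq => ?_
  refine isDerivFinite_treeSeries hLive hsub (fun t ht => ?_) (Finset.mem_filter.1 hq).2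
  rw [ha]
  exact Finset.single_le_sum (f := numLabel) (fun _ _ => Nat.zero_le _)
    (Finset.mem_filter.2 ⟨mem_ofSize.2 rfl, ht⟩)

end Rationality

/-! ### An automaton for pattern avoidance. -/

section Patterns

open PTree

variable {Υ : Generators}

/-- The subtrees of a tree. -/
def subtrees : PTree Υ Unit → Set (PTree Υ Unit)
  | .leaf _ => {.leaf ()}
  | .node μ c => insert (.node μ c) (⋃ i, subtrees (c i))

theorem finite_subtrees (t : PTree Υ Unit) : (subtrees t).Finite := by
  induction t with
  | leaf x => exact Set.finite_singleton _
  | node μ c ih => exact (Set.finite_iUnion ih).insert _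

theorem self_mem_subtrees (t : PTree Υ Unit) : t ∈ subtrees t := by
  cases t with
  | leaf x => exact rfl
  | node μ c => exact Set.mem_insert _ _

theorem child_mem_subtrees {t : PTree Υ Unit} {μ : Υ.op} {c : Fin (Υ.ar μ) → PTree Υ Unit}
    (h : PTree.node μ c ∈ subtrees t) (i : Fin (Υ.ar μ)) : c i ∈ subtrees t := by
  induction t with
  | leaf x => cases h
  | node ν d ih =>
    rcases h with h | h
    · cases h
      exact Set.mem_insert_of_mem _ (Set.mem_iUnion.2 ⟨i, self_mem_subtrees _⟩)
    · obtain ⟨j, hj⟩ := Set.mem_iUnion.1 h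
      exact Set.mem_insert_of_mem _ (Set.mem_iUnion.2 ⟨j, ih j hj⟩)

/-- States of the automaton recognizing the patterns from `S`: the set of subtrees of patterns
that match at the root, and whether some pattern occurs. -/
abbrev PatternState (S : Set (PTree Υ Unit)) : Type :=
  Set (⋃ p ∈ S, subtrees p) × Prop

/-- The subtrees of patterns matching at a vertex, in terms of the states of its inputs. -/
def matchedAt (S : Set (PTree Υ Unit)) (μ : Υ.op) (x : Fin (Υ.ar μ) → PatternState S) :
    Set (⋃ p ∈ S, subtrees p) :=
  {p | p.1 = .leaf () ∨ ∃ d, p.1 = .node μ d ∧ ∀ i, ∃ q ∈ (x i).1, q.1 = d i}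

/-- The initial state of the pattern automaton. -/
def patternStart (S : Set (PTree Υ Unit)) : PatternState S :=
  ({p | p.1 = .leaf ()}, PTree.leaf () ∈ S)

/-- The transitions of the pattern automaton. -/
def patternStep (S : Set (PTree Υ Unit)) (μ : Υ.op) (x : Fin (Υ.ar μ) → PatternState S) :
    PatternState S :=
  (matchedAt S μ x, (∃ p ∈ matchedAt S μ x, p.1 ∈ S) ∨ ∃ i, (x i).2)

theorem topMatch_leaf_right {p : PTree Υ Unit} : TopMatch p (.leaf () : PTree Υ Unit) ↔
    p = .leaf () := by
  constructor
  · intro h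
    cases h
    rfl
  · rintro rfl
    exact .leaf _ _

theorem topMatch_node_right {p : PTree Υ Unit} {μ : Υ.op} {c : Fin (Υ.ar μ) → PTree Υ Unit} :
    TopMatch p (.node μ c) ↔ p = .leaf () ∨ ∃ d, p = .node μ d ∧ ∀ i, TopMatch (d i) (c i) := by
  constructor
  · intro h
    cases h with
    | leaf x => exact Or.inl rfl
    | node h => exact Or.inr ⟨_, rfl, h⟩
  · rintro (rfl | ⟨d, rfl, h⟩)
    · exact .leaf _ _
    · exact .node h

/-- Whether a pattern matches at a vertex depends only on which of its child subtrees match at the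
children. Recording all subtrees of patterns, a family closed under passing to children, therefore
determines the transitions. -/
theorem run_pattern (S : Set (PTree Υ Unit)) (t : PTree Υ Unit) :
    run (patternStart S) (patternStep S) t = ({p | TopMatch p.1 t}, Divisible S t) := by
  induction t with
  | leaf x =>
    refine Prod.ext (Set.ext fun p => topMatch_leaf_right.symm) (propext ?_)
    change _ ↔ ∃ p ∈ S, Contains p (.leaf ())
    simp only [contains_leaf, topMatch_leaf_right, exists_eq_right]
    rfl
  | node μ c ih =>
    have h1 : matchedAt S μ (fun i => run (patternStart S) (patternStep S) (c i)) =
        {p | TopMatch p.1 (.node μ c)} := by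
      ext ⟨p, hp⟩
      obtain ⟨s, hs, hps⟩ := Set.mem_iUnion₂.1 hp
      simp only [matchedAt, ih, Set.mem_ofPred_eq, topMatch_node_right]
      refine or_congr_right (exists_congr fun d => and_congr_right fun hd => forall_congr' fun i =>
        ⟨?_, fun h => ?_⟩)
      · rintro ⟨q, hq, he⟩
        exact he ▸ hq
      · subst hd
        exact ⟨⟨d i, Set.mem_iUnion₂.2 ⟨s, hs, child_mem_subtrees hps i⟩⟩, h, rfl⟩
    refine Prod.ext h1 (propext ?_)
    change (∃ p ∈ matchedAt S μ _, p.1 ∈ S) ∨ _ ↔ ∃ p ∈ S, Contains p (.node μ c)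
    rw [h1]
    simp only [ih, contains_node, Divisible]
    constructor
    · rintro (⟨p, hp, hpS⟩ | ⟨i, p, hpS, hp⟩)
      · exact ⟨p.1, hpS, Or.inl hp⟩
      · exact ⟨p, hpS, Or.inr ⟨i, hp⟩⟩
    · rintro ⟨p, hpS, hp | ⟨i, hp⟩⟩
      · exact Or.inl ⟨⟨p, Set.mem_iUnion₂.2 ⟨p, hpS, self_mem_subtrees p⟩⟩, hp, hpS⟩
      · exact Or.inr ⟨i, p, hpS, hp⟩

/-- The exponential generating series of an operad of subfactorial growth with a finite shuffle
regular Gröbner basis. -/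
theorem isDerivFinite_expSeries_dim {k : Type u} [Field k] {P : ShuffleOperad.{u, v} k}
    (hP : P.HasShuffleRegularFiniteGroebnerBasis) (hsub : Subfactorial P.dim) :
    IsDerivFinite (expSeries P.dim) := by
  classical
  obtain ⟨Υ, S, hS, hdim⟩ := exists_dim_eq_card hP
  have : Finite (⋃ p ∈ S, subtrees p) := (hS.biUnion fun p _ => finite_subtrees p).to_subtype
  have := Fintype.ofFinite (PatternState S)
  -- Live states are those in which no pattern has occurred; an occurrence in a child persists in
  -- the parent, so liveness passes to children.
  refine isDerivFinite_expSeries_of_automaton (q₀ := patternStart S) (δ := patternStep S)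
    (Live := fun q => ¬ q.2) (fun μ x h i hi => h (Or.inr ⟨i, hi⟩)) hsub fun n => ?_
  rw [hdim]
  have h := card_monomial_eq_sum (Υ := Υ) (fun s => ¬ Divisible S s) (Finset.Icc 1 n)
  simp only [Divisible, contains_skeleton, Nat.card_Icc, Nat.add_sub_cancel] at h
  simp only [run_pattern]
  exact h

end Patterns

end ShOp

/-! ### Differential equations, recurrences and rational series. -/

namespace ShOp

open PowerSeries

section Recurrence

/-- Cayley–Hamilton for differentiation on a stable space containing `F`; the characteristic
polynomial is monic, so the equation is nontrivial. -/
theorem IsDerivFinite.satisfiesConstCoeffODE {F : ℚ⟦X⟧} (hF : IsDerivFinite F) :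
    SatisfiesConstCoeffODE F := by
  obtain ⟨V, hV, hV', hFV⟩ := hF
  let E : V →ₗ[ℚ] V := (d⁄dX ℚ : ℚ⟦X⟧ →ₗ[ℚ] ℚ⟦X⟧).restrict hV'
  have hE : ∀ i : ℕ, (((E ^ i) ⟨F, hFV⟩ : V) : ℚ⟦X⟧) = (d⁄dX ℚ)^[i] F := by
    intro i
    induction i with
    | zero => rfl
    | succ i ih => rw [pow_succ', Function.iterate_succ_apply', ← ih]; rfl
  refine ⟨E.charpoly.natDegree, E.charpoly.coeff, ?_, ?_⟩
  · rw [Polynomial.coeff_natDegree, E.charpoly_monic.leadingCoeff]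
    exact one_ne_zero
  · have h := congrArg (fun L : V →ₗ[ℚ] V => ((L ⟨F, hFV⟩ : V) : ℚ⟦X⟧)) E.aeval_self_charpoly
    simp only [Polynomial.aeval_eq_sum_range, LinearMap.sum_apply, LinearMap.smul_apply,
      Submodule.coe_sum, Submodule.coe_smul, hE] at h
    exact h

/-- Differentiating an exponential series shifts the underlying sequence. The index zero is
consistent because both series omit it. -/
theorem coeff_iterate_derivative_expSeries (a : ℕ → ℕ) (i n : ℕ) :
    coeff n ((d⁄dX ℚ)^[i] (expSeries a)) = coeff (n + i) (ordSeries a) / n.factorial := by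
  rw [coeff_iterate_derivative, expSeries, ordSeries, coeff_mk, coeff_mk]
  split_ifs
  · simp
  · have h := Nat.factorial_mul_ascFactorial n i
    rw [← h]
    have h1 : ((n + 1).ascFactorial i : ℚ) ≠ 0 := Nat.cast_ne_zero.2 (Nat.ascFactorial_pos n i).ne'
    push_cast
    field_simp

theorem sum_iterate_derivative_expSeries_eq_zero_iff (a : ℕ → ℕ) (N : ℕ) (c : ℕ → ℚ) :
    ∑ i ∈ Finset.range (N + 1), c i • (d⁄dX ℚ)^[i] (expSeries a) = 0 ↔
      ∀ n, ∑ i ∈ Finset.range (N + 1), c i * coeff (n + i) (ordSeries a) = 0 := by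
  rw [PowerSeries.ext_iff]
  refine forall_congr' fun n => ?_
  simp only [map_sum, map_smul, coeff_iterate_derivative_expSeries, map_zero, smul_eq_mul,
    ← mul_div_assoc]
  rw [← Finset.sum_div, div_eq_zero_iff]
  exact or_iff_left (by positivity)

/-- Multiplication by a polynomial acts on high coefficients as a recurrence with the coefficients
reversed. -/
theorem coeff_mul_eq_sum_reflect {q : Polynomial ℚ} {M : ℕ} (hM : q.natDegree ≤ M) (F : ℚ⟦X⟧)
    (n : ℕ) : coeff (n + M) ((q : ℚ⟦X⟧) * F) =
      ∑ i ∈ Finset.range (M + 1), q.coeff (M - i) * coeff (n + i) F := by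
  rw [coeff_mul, Finset.Nat.sum_antidiagonal_eq_sum_range_succ_mk]
  simp only [Polynomial.coeff_coe]
  rw [← Finset.sum_range_reflect (fun i => q.coeff (M - i) * coeff (n + i) F)]
  symm
  refine (Finset.sum_congr rfl fun i hi => ?_).trans
    (Finset.sum_subset (Finset.range_mono (by omega : M + 1 ≤ n + M + 1)) fun i _ hi => ?_)
  · have := Finset.mem_range.1 hi
    rw [show M - (M + 1 - 1 - i) = i by omega, show n + (M + 1 - 1 - i) = n + M - i by omega]
  · rw [Finset.mem_range] at hi
    rw [Polynomial.coeff_eq_zero_of_natDegree_lt (by omega), zero_mul]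

/-- The operator and the denominator have reversed coefficients. A recurrence valid for all `n` says
that the product with the denominator is a polynomial. -/
theorem satisfiesConstCoeffODE_iff_isRationalSeries (a : ℕ → ℕ) :
    SatisfiesConstCoeffODE (expSeries a) ↔ IsRationalSeries (ordSeries a) := by
  constructor
  · rintro ⟨N, c, hc, h⟩
    rw [sum_iterate_derivative_expSeries_eq_zero_iff] at h
    let q : Polynomial ℚ := ∑ i ∈ Finset.range (N + 1), Polynomial.monomial (N - i) (c i)
    have hq : ∀ i, i ≤ N → q.coeff (N - i) = c i := by
      intro i hi
      simp only [q, Polynomial.finsetSum_coeff, Polynomial.coeff_monomial]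
      rw [Finset.sum_eq_single_of_mem i (Finset.mem_range.2 (by omega))]
      · simp
      · intro j hj hji
        have := Finset.mem_range.1 hj
        exact if_neg (by omega)
    have hdeg : q.natDegree ≤ N := Polynomial.natDegree_sum_le_of_forall_le _ _ fun i _ =>
      (Polynomial.natDegree_monomial_le _).trans (Nat.sub_le N i)
    refine ⟨trunc N ((q : ℚ⟦X⟧) * ordSeries a), q, ?_, ?_⟩
    · rintro h0
      have := hq N le_rfl
      rw [h0, Polynomial.coeff_zero] at this
      exact hc this.symm
    · ext n
      rw [Polynomial.coeff_coe, coeff_trunc]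
      split_ifs with hn
      · rfl
      · obtain ⟨m, rfl⟩ := Nat.exists_eq_add_of_le' (not_lt.1 hn)
        rw [coeff_mul_eq_sum_reflect hdeg, ← h m]
        refine Finset.sum_congr rfl fun i hi => ?_
        rw [hq i (by have := Finset.mem_range.1 hi; omega)]
  · rintro ⟨p, q, hq, h⟩
    -- Beyond degree `p.natDegree` the product vanishes, so this `M` makes the recurrence hold from
    -- `n = 0`. Shortening it by the order `j` of vanishing of `q` at zero makes the top coefficient
    -- nonzero.
    let M := max q.natDegree (p.natDegree + 1)
    let j := q.natTrailingDegree
    have hj : j ≤ q.natDegree := Polynomial.natTrailingDegree_le_natDegree q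
    have hM : q.natDegree ≤ M := le_max_left _ _
    refine ⟨M - j, fun i => q.coeff (M - i), ?_, ?_⟩
    · dsimp only
      rw [Nat.sub_sub_self (hj.trans hM)]
      exact Polynomial.trailingCoeff_nonzero_iff_nonzero.2 hq
    · rw [sum_iterate_derivative_expSeries_eq_zero_iff]
      intro n
      have h1 := coeff_mul_eq_sum_reflect hM (ordSeries a) n
      rw [h, Polynomial.coeff_coe, Polynomial.coeff_eq_zero_of_natDegree_lt
        ((Nat.lt_of_succ_le (le_max_right _ _ : p.natDegree + 1 ≤ M)).trans_le
          (Nat.le_add_left M n))] at h1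
      rw [h1]
      refine Finset.sum_subset (Finset.range_mono (by omega)) fun i hi hi' => ?_
      rw [Finset.mem_range] at hi hi'
      rw [Polynomial.coeff_eq_zero_of_lt_natTrailingDegree (by omega : M - i < j), zero_mul]

/-- The bound is the `n`-th power of `(n / A) ^ (1 / B)`, which eventually exceeds `|b|`. -/
theorem subfactorial_of_le_pow {a : ℕ → ℕ} (h : ∃ b : ℝ, ∀ n : ℕ, 1 ≤ n → (a n : ℝ) ≤ b ^ n) :
    Subfactorial a := by
  obtain ⟨b, hb⟩ := h
  intro A B hA hB
  refine ⟨1, one_pos, ?_⟩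
  have h1 : Filter.Tendsto (fun n : ℕ => ((n : ℝ) / A) ^ (1 / B)) Filter.atTop Filter.atTop :=
    (tendsto_rpow_atTop (by positivity)).comp
      (tendsto_natCast_atTop_atTop.atTop_div_const hA)
  filter_upwards [h1.eventually_gt_atTop |b|, Filter.eventually_ge_atTop 1] with n hn hn1
  have h2 : ((n : ℝ) / A) ^ ((n : ℝ) / B) = (((n : ℝ) / A) ^ (1 / B)) ^ n := by
    rw [← Real.rpow_natCast, ← Real.rpow_mul (by positivity)]
    congr 1
    ring
  rw [one_mul, h2]
  calc (a n : ℝ) ≤ |b ^ n| := (hb n hn1).trans (le_abs_self _)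
    _ = |b| ^ n := abs_pow b n
    _ < _ := pow_lt_pow_left₀ hn (abs_nonneg b) (by omega)

end Recurrence

/-! ### Growth of solutions of linear recurrences. -/

section Growth

open Filter Topology

/-- The shift of sequences. -/
def seqShift : (ℕ → ℂ) →ₗ[ℂ] (ℕ → ℂ) where
  toFun x n := x (n + 1)
  map_add' _ _ := rfl
  map_smul' _ _ := rfl

/-- The sequence is eventually a linear combination of the sequences `z ^ n * n.choose k` with
nonzero `z`. -/
def EventuallyExpPoly (x : ℕ → ℂ) : Prop :=
  ∃ c : ℂ × ℕ →₀ ℂ, (∀ p ∈ c.support, p.1 ≠ 0) ∧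
    ∀ᶠ n in atTop, x n = c.sum fun p r => r * (p.1 ^ n * n.choose p.2)

theorem EventuallyExpPoly.add {x y : ℕ → ℂ} (hx : EventuallyExpPoly x)
    (hy : EventuallyExpPoly y) : EventuallyExpPoly (x + y) := by
  classical
  obtain ⟨c, hc, hxc⟩ := hx
  obtain ⟨d, hd, hyd⟩ := hy
  refine ⟨c + d, fun p hp => ?_, ?_⟩
  · rcases Finset.mem_union.1 (Finsupp.support_add hp) with h | h
    · exact hc p h
    · exact hd p h
  · filter_upwards [hxc, hyd] with n h1 h2
    rw [Pi.add_apply, h1, h2, Finsupp.sum_add_index' (fun _ => zero_mul _)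
      fun _ _ _ => add_mul _ _ _]

theorem EventuallyExpPoly.of_eventually_zero {x : ℕ → ℂ} (hx : ∀ᶠ n in atTop, x n = 0) :
    EventuallyExpPoly x :=
  ⟨0, by simp, by simpa using hx⟩

theorem seqShift_pow_apply (m : ℕ) (x : ℕ → ℂ) (n : ℕ) :
    (seqShift ^ m) x n = x (n + m) := by
  induction m generalizing n with
  | zero => rfl
  | succ m ih =>
    rw [pow_succ', Module.End.mul_apply]
    change (seqShift ^ m) x (n + 1) = _
    rw [ih]
    congr 1
    omega

/-- Conjugation by `z ^ n` turns the shift minus `z` into `z` times the forward difference. -/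
theorem seqShift_sub_pow_apply (z : ℂ) (f : ℕ → ℂ) (m n : ℕ) :
    ((seqShift - algebraMap ℂ (Module.End ℂ (ℕ → ℂ)) z) ^ m) (fun n => z ^ n * f n) n =
      z ^ (n + m) * ((fwdDiff 1)^[m] f) n := by
  induction m generalizing n with
  | zero => rfl
  | succ m ih =>
    rw [pow_succ', Module.End.mul_apply, LinearMap.sub_apply, Pi.sub_apply,
      Module.algebraMap_end_apply, Pi.smul_apply, ih, Function.iterate_succ_apply', fwdDiff]
    change ((seqShift - algebraMap ℂ (Module.End ℂ (ℕ → ℂ)) z) ^ m) _ (n + 1) - _ = _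
    rw [ih, smul_eq_mul]
    ring

/-- For `z = 0` the sequence vanishes from index `m` on. Otherwise `x n / z ^ n` has vanishing
`m`-th difference, and Newton's forward difference formula expands it in binomial coefficients. -/
theorem EventuallyExpPoly.of_pow_eq_zero {x : ℕ → ℂ} {z : ℂ} {m : ℕ}
    (hx : ((seqShift - algebraMap ℂ (Module.End ℂ (ℕ → ℂ)) z) ^ m) x = 0) :
    EventuallyExpPoly x := by
  by_cases hz : z = 0
  · rw [hz, map_zero, sub_zero] at hx
    refine .of_eventually_zero ?_
    filter_upwards [eventually_ge_atTop m] with n hn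
    obtain ⟨l, rfl⟩ := Nat.exists_eq_add_of_le' hn
    rw [← seqShift_pow_apply m x l, hx]
    rfl
  · let f : ℕ → ℂ := fun n => x n / z ^ n
    have hxf : x = fun n => z ^ n * f n := by
      funext n
      have : z ^ n ≠ 0 := pow_ne_zero n hz
      simp only [f]
      field_simp
    have hΔ : (fwdDiff 1)^[m] f = 0 := by
      funext n
      have h := seqShift_sub_pow_apply z f m n
      rw [← hxf, hx] at h
      exact (mul_eq_zero.1 h.symm).resolve_left (pow_ne_zero _ hz)
    have hΔ' : ∀ k, m ≤ k → (fwdDiff 1)^[k] f 0 = 0 := by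
      intro k hk
      obtain ⟨l, rfl⟩ := Nat.exists_eq_add_of_le' hk
      rw [Function.iterate_add_apply, hΔ]
      have : ∀ l, (fwdDiff 1)^[l] (0 : ℕ → ℂ) = 0 := by
        intro l
        induction l with
        | zero => rfl
        | succ l ih =>
          rw [Function.iterate_succ_apply', ih]
          funext n
          simp [fwdDiff]
      rw [this]
      rfl
    refine ⟨∑ k ∈ Finset.range m, Finsupp.single (z, k) ((fwdDiff 1)^[k] f 0), fun p hp => ?_,
      Eventually.of_forall fun n => ?_⟩
    · classical
      obtain ⟨k, -, hk⟩ := Finset.mem_biUnion.1 (Finsupp.support_finsetSum hp)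
      have := Finsupp.support_single_subset hk
      rw [Finset.mem_singleton.1 this]
      exact hz
    · rw [← Finsupp.sum_finsetSum_index (fun _ => zero_mul _) fun _ _ _ => add_mul _ _ _]
      simp only [Finsupp.sum_single_index, zero_mul]
      have h := shift_eq_sum_fwdDiff_iter 1 f n 0
      simp only [smul_eq_mul, mul_one, zero_add, nsmul_eq_mul] at h
      have h2 : f n = ∑ k ∈ Finset.range m, (n.choose k : ℂ) * (fwdDiff 1)^[k] f 0 := by
        rw [h]
        rcases le_total (n + 1) m with hle | hle
        · refine Finset.sum_subset (Finset.range_mono hle) fun k _ hk => ?_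
          rw [Nat.choose_eq_zero_of_lt (by simpa using hk), Nat.cast_zero, zero_mul]
        · refine (Finset.sum_subset (Finset.range_mono hle) fun k _ hk => ?_).symm
          rw [hΔ' k (by simpa using hk), mul_zero]
      rw [congrFun hxf n, h2, Finset.mul_sum]
      exact Finset.sum_congr rfl fun k _ => by ring

/-- The shift acts on the finite-dimensional solution space, which over `ℂ` is the sum of its
generalized eigenspaces. -/
theorem EventuallyExpPoly.of_recurrence (E : LinearRecurrence ℂ) {x : ℕ → ℂ}
    (hx : E.IsSolution x) : EventuallyExpPoly x := by
  have hstab : ∀ u ∈ E.solSpace, seqShift u ∈ E.solSpace := by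
    intro u hu n
    have := hu (n + 1)
    simp only [seqShift, LinearMap.coe_mk, AddHom.coe_mk]
    rw [show n + E.order + 1 = n + 1 + E.order by omega, this]
    exact Finset.sum_congr rfl fun i _ => by rw [show n + 1 + (i : ℕ) = n + i + 1 by omega]
  have : FiniteDimensional ℂ E.solSpace := Module.Finite.of_basis E.basis
  let T : Module.End ℂ E.solSpace := seqShift.restrict hstab
  have hT : ∀ (z : ℂ) (m : ℕ) (u : E.solSpace),
      (((T - algebraMap ℂ (Module.End ℂ E.solSpace) z) ^ m) u : ℕ → ℂ) =
        ((seqShift - algebraMap ℂ (Module.End ℂ (ℕ → ℂ)) z) ^ m) u := by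
    intro z m u
    induction m with
    | zero => rfl
    | succ m ih => rw [pow_succ', pow_succ', Module.End.mul_apply, Module.End.mul_apply, ← ih]; rfl
  have key : ∀ u : E.solSpace, EventuallyExpPoly u := by
    intro u
    have hu : u ∈ ⨆ z, T.maxGenEigenspace z := by
      rw [Module.End.iSup_maxGenEigenspace_eq_top]; trivial
    induction hu using Submodule.iSup_induction' with
    | mem z u hu =>
      obtain ⟨m, hm⟩ := (Module.End.mem_maxGenEigenspace T z u).1 hu
      refine .of_pow_eq_zero (z := z) (m := m) ?_
      rw [← hT]
      exact congrArg Subtype.val hm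
    | zero => exact .of_eventually_zero (Eventually.of_forall fun _ => rfl)
    | add u v _ _ hu hv => exact hu.add hv
  exact key ⟨x, hx⟩

theorem eventuallyExpPoly_of_satisfiesConstCoeffODE {a : ℕ → ℕ}
    (h : SatisfiesConstCoeffODE (expSeries a)) : EventuallyExpPoly fun n => (a n : ℂ) := by
  obtain ⟨N, c, hc, h⟩ := h
  rw [sum_iterate_derivative_expSeries_eq_zero_iff] at h
  let y : ℕ → ℂ := fun n => ((coeff n (ordSeries a) : ℚ) : ℂ)
  have hy : EventuallyExpPoly y := by
    refine .of_recurrence ⟨N, fun i => ((-c i / c N : ℚ) : ℂ)⟩ fun n => ?_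
    have h1 := h n
    rw [Finset.sum_range_succ, ← Fin.sum_univ_eq_sum_range] at h1
    have h2 : coeff (n + N) (ordSeries a) =
        ∑ i : Fin N, (-c i / c N) * coeff (n + i) (ordSeries a) := by
      have h3 : ∀ i : Fin N, (-c i / c N) * coeff (n + i) (ordSeries a) =
          -(c i * coeff (n + i) (ordSeries a)) / c N := fun i => by ring
      rw [Finset.sum_congr rfl fun i _ => h3 i, ← Finset.sum_div, Finset.sum_neg_distrib,
        eq_div_iff hc]
      linarith
    change ((coeff (n + N) (ordSeries a) : ℚ) : ℂ) = ∑ i : Fin N, _ * _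
    rw [h2]
    push_cast
    rfl
  obtain ⟨d, hd, hyd⟩ := hy
  refine ⟨d, hd, ?_⟩
  -- The series ignores `a 0`, so the comparison starts at index one.
  filter_upwards [hyd, eventually_ge_atTop 1] with n hn hn1
  rw [← hn]
  simp only [y, ordSeries, coeff_mk]
  rw [if_neg (by omega)]
  simp

/-- Among any sufficiently many consecutive values of a nonzero combination of powers of distinct
unimodular numbers, one is bounded away from zero. -/
theorem exists_window_lower_bound {ι : Type} {T : Finset ι} {u g : ι → ℂ}
    (hu : ∀ i ∈ T, ‖u i‖ = 1) (hinj : Set.InjOn u T) {i₀ : ι} (hi₀ : i₀ ∈ T) (hg : g i₀ ≠ 0) :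
    ∃ (κ : ℝ) (w : ℕ), 0 < κ ∧ ∀ n, ∃ j, n ≤ j ∧ j < n + w ∧ κ ≤ ‖∑ i ∈ T, g i * u i ^ j‖ := by
  classical
  -- `P` vanishes at every `u i` except `u i₀`, so weighting consecutive values by its coefficients
  -- isolates the term of `i₀`, whose modulus is constant in `n`.
  let P : Polynomial ℂ := ∏ i ∈ T.erase i₀, (Polynomial.X - Polynomial.C (u i))
  have hP : ∀ i ∈ T, i ≠ i₀ → P.eval (u i) = 0 := by
    intro i hi hne
    rw [Polynomial.eval_prod]
    exact Finset.prod_eq_zero (Finset.mem_erase.2 ⟨hne, hi⟩) (by simp)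
  have hP₀ : P.eval (u i₀) ≠ 0 := by
    rw [Polynomial.eval_prod]
    refine Finset.prod_ne_zero_iff.2 fun i hi => ?_
    obtain ⟨hne, hi⟩ := Finset.mem_erase.1 hi
    simp only [Polynomial.eval_sub, Polynomial.eval_X, Polynomial.eval_C]
    exact sub_ne_zero.2 fun h => hne (hinj hi hi₀ h.symm)
  have hsum : ∀ n, ∑ j ∈ Finset.range (P.natDegree + 1),
      P.coeff j * ∑ i ∈ T, g i * u i ^ (n + j) = g i₀ * u i₀ ^ n * P.eval (u i₀) := by
    intro n
    have : ∀ i ∈ T, ∑ j ∈ Finset.range (P.natDegree + 1), P.coeff j * (g i * u i ^ (n + j)) =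
        g i * u i ^ n * P.eval (u i) := by
      intro i _
      rw [Polynomial.eval_eq_sum_range, Finset.mul_sum]
      exact Finset.sum_congr rfl fun j _ => by ring
    simp only [Finset.mul_sum]
    rw [Finset.sum_comm, Finset.sum_congr rfl this]
    refine Finset.sum_eq_single_of_mem i₀ hi₀ fun i hi hne => ?_
    rw [hP i hi hne, mul_zero]
  let κ := ‖g i₀‖ * ‖P.eval (u i₀)‖
  have hκ : 0 < κ := mul_pos (norm_pos_iff.2 hg) (norm_pos_iff.2 hP₀)
  let M := ∑ j ∈ Finset.range (P.natDegree + 1), ‖P.coeff j‖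
  have hM : 0 ≤ M := Finset.sum_nonneg fun _ _ => norm_nonneg _
  -- If all values in the window were below `κ / (M + 1)`, the isolated term would have modulus at
  -- most `M * κ / (M + 1) < κ`.
  refine ⟨κ / (M + 1), P.natDegree + 1, by positivity, fun n => ?_⟩
  by_contra! hcon
  have h1 : κ ≤ M * (κ / (M + 1)) := by
    calc κ = ‖g i₀ * u i₀ ^ n * P.eval (u i₀)‖ := by
          rw [norm_mul, norm_mul, norm_pow, hu i₀ hi₀, one_pow, mul_one]
      _ ≤ ∑ j ∈ Finset.range (P.natDegree + 1),
          ‖P.coeff j‖ * ‖∑ i ∈ T, g i * u i ^ (n + j)‖ := by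
        rw [← hsum]
        exact (norm_sum_le _ _).trans (Finset.sum_le_sum fun j _ => norm_mul_le _ _)
      _ ≤ ∑ j ∈ Finset.range (P.natDegree + 1), ‖P.coeff j‖ * (κ / (M + 1)) :=
        Finset.sum_le_sum fun j hj => mul_le_mul_of_nonneg_left
          (hcon (n + j) (by omega) (by have := Finset.mem_range.1 hj; omega)).le (norm_nonneg _)
      _ = M * (κ / (M + 1)) := (Finset.sum_mul _ _ _).symm
  rw [mul_div_assoc', le_div_iff₀ (by positivity)] at h1
  linarith

theorem tendsto_choose_div_pow (d : ℕ) :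
    Tendsto (fun n : ℕ => (n.choose d : ℝ) / (n : ℝ) ^ d) atTop (𝓝 (1 / d.factorial)) := by
  have h := (isEquivalent_choose d).div
    (Asymptotics.IsEquivalent.refl (u := fun n : ℕ => (n : ℝ) ^ d) (l := atTop))
  refine h.symm.tendsto_nhds (tendsto_const_nhds.congr' ?_)
  filter_upwards [eventually_ge_atTop 1] with n hn
  have : (n : ℝ) ^ d ≠ 0 := by positivity
  simp only [Pi.div_apply]
  field_simp

/-- After normalisation a term of smaller modulus decays geometrically up to a power of `n`, and one
of maximal modulus but lower degree decays at least like `1 / n`. Only the dominant terms persist,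
each as a constant times a unimodular power. -/
theorem tendsto_expPoly_term {z : ℂ} {k d : ℕ} {b : ℝ} (hb : 0 < b) (hz : ‖z‖ ≤ b)
    (hk : ‖z‖ = b → k ≤ d) :
    Tendsto (fun n : ℕ => z ^ n * n.choose k / ((n : ℂ) ^ d * (b : ℂ) ^ n) -
      if ‖z‖ = b ∧ k = d then 1 / (d.factorial : ℂ) * (z / b) ^ n else 0) atTop (𝓝 0) := by
  rw [tendsto_zero_iff_norm_tendsto_zero]
  have hbC : (b : ℂ) ≠ 0 := Complex.ofReal_ne_zero.2 hb.ne'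
  split_ifs with h
  · obtain ⟨h1, rfl⟩ := h
    have h2 : Tendsto (fun n : ℕ => |(n.choose k : ℝ) / (n : ℝ) ^ k - 1 / k.factorial|) atTop
        (𝓝 0) := by
      have := ((tendsto_choose_div_pow k).sub_const (1 / (k.factorial : ℝ))).abs
      simpa using this
    refine h2.congr fun n => ?_
    have h3 : z ^ n * n.choose k / ((n : ℂ) ^ k * (b : ℂ) ^ n) -
        1 / (k.factorial : ℂ) * (z / b) ^ n =
        (z / b) ^ n * (((n.choose k : ℝ) / (n : ℝ) ^ k - 1 / k.factorial : ℝ) : ℂ) := by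
      push_cast
      rw [div_pow]
      ring
    rw [h3, norm_mul, norm_pow, norm_div, Complex.norm_real, Complex.norm_real, Real.norm_eq_abs,
      Real.norm_eq_abs, abs_of_pos hb, h1, div_self hb.ne', one_pow, one_mul]
  · simp only [sub_zero, norm_div, norm_mul, norm_pow, Complex.norm_natCast, Complex.norm_real,
      Real.norm_eq_abs, abs_of_pos hb]
    rcases hz.lt_or_eq with hlt | heq
    · have hr : ‖z‖ / b < 1 := (div_lt_one hb).2 hlt
      refine squeeze_zero' (Eventually.of_forall fun n => by positivity) ?_
        (tendsto_pow_const_mul_const_pow_of_lt_one k (by positivity) hr)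
      filter_upwards [eventually_ge_atTop 1] with n hn
      have h1 : (1 : ℝ) ≤ (n : ℝ) ^ d := one_le_pow₀ (by exact_mod_cast hn)
      have h2 : (n.choose k : ℝ) ≤ (n : ℝ) ^ k := by exact_mod_cast Nat.choose_le_pow n k
      rw [div_pow, mul_div_assoc', div_le_div_iff₀ (by positivity) (by positivity)]
      have h3 : ‖z‖ ^ n * n.choose k ≤ (n : ℝ) ^ k * ‖z‖ ^ n * (n : ℝ) ^ d := by
        rw [mul_comm]
        calc (n.choose k : ℝ) * ‖z‖ ^ n ≤ (n : ℝ) ^ k * ‖z‖ ^ n := by gcongr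
          _ ≤ _ := le_mul_of_one_le_right (by positivity) h1
      calc ‖z‖ ^ n * n.choose k * b ^ n ≤ (n : ℝ) ^ k * ‖z‖ ^ n * (n : ℝ) ^ d * b ^ n := by gcongr
        _ = _ := by ring
    · have hlt : k < d := lt_of_le_of_ne (hk heq) fun h' => h ⟨heq, h'⟩
      refine squeeze_zero' (Eventually.of_forall fun n => by positivity) ?_
        tendsto_one_div_atTop_nhds_zero_nat
      filter_upwards [eventually_ge_atTop 1] with n hn
      have hn1 : (1 : ℝ) ≤ n := by exact_mod_cast hn
      have h2 : (n.choose k : ℝ) ≤ (n : ℝ) ^ k := by exact_mod_cast Nat.choose_le_pow n k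
      have h3 : (n : ℝ) ^ k * n ≤ (n : ℝ) ^ d := by
        rw [← pow_succ]
        exact pow_le_pow_right₀ hn1 hlt
      rw [heq, div_le_div_iff₀ (by positivity) (by positivity)]
      calc b ^ n * n.choose k * n ≤ b ^ n * (n : ℝ) ^ k * n := by gcongr
        _ = b ^ n * ((n : ℝ) ^ k * n) := by ring
        _ ≤ b ^ n * (n : ℝ) ^ d := by gcongr
        _ = _ := by ring

/-- Here `b` is the maximal modulus and `d` the largest degree attained with it. The normalised
sequence differs by a null sequence from the sum `U` of dominant terms, which is bounded and, once
in every window, bounded below by `κ`; half of `κ` absorbs the error. -/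
theorem growsLike_of_eventuallyExpPoly {a : ℕ → ℕ} (h : EventuallyExpPoly fun n => (a n : ℂ)) :
    (∀ᶠ n in atTop, a n = 0) ∨
      ∃ (b : ℝ) (d : ℕ), 0 < b ∧ GrowsLike a fun n => (n : ℝ) ^ d * b ^ n := by
  obtain ⟨c, hc, hac⟩ := h
  by_cases hne : c.support.Nonempty
  swap
  · left
    have : c = 0 := Finsupp.support_eq_empty.1 (Finset.not_nonempty_iff_eq_empty.1 hne)
    filter_upwards [hac] with n hn
    simpa [this] using hn
  right
  obtain ⟨p₁, hp₁, hmax₁⟩ := c.support.exists_max_image (fun p => ‖p.1‖) hne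
  let b := ‖p₁.1‖
  have hb : 0 < b := norm_pos_iff.2 (hc p₁ hp₁)
  obtain ⟨p₀, hp₀, hmax₀⟩ := (c.support.filter fun p => ‖p.1‖ = b).exists_max_image (fun p => p.2)
    ⟨p₁, Finset.mem_filter.2 ⟨hp₁, rfl⟩⟩
  obtain ⟨hp₀s, hp₀b⟩ := Finset.mem_filter.1 hp₀
  let d := p₀.2
  let T := c.support.filter fun p => ‖p.1‖ = b ∧ p.2 = d
  have hbC : ‖(b : ℂ)‖ = b := by rw [Complex.norm_real, Real.norm_eq_abs, abs_of_pos hb]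
  have hbC0 : (b : ℂ) ≠ 0 := Complex.ofReal_ne_zero.2 hb.ne'
  have hT : ∀ p ∈ T, ‖p.1 / (b : ℂ)‖ = 1 := by
    intro p hp
    rw [norm_div, hbC, (Finset.mem_filter.1 hp).2.1, div_self hb.ne']
  obtain ⟨κ, w, hκ, hw⟩ := exists_window_lower_bound (T := T) (u := fun p => p.1 / (b : ℂ))
    (g := fun p => c p * (1 / (d.factorial : ℂ))) hT
    (by
      -- Dominant terms share the degree `d`, so equal bases mean equal terms.
      intro p hp q hq hpq
      have h1 : p.1 = q.1 := (div_left_inj' hbC0).1 hpq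
      exact Prod.ext h1
        ((Finset.mem_filter.1 hp).2.2.trans (Finset.mem_filter.1 hq).2.2.symm))
    (i₀ := p₀) (Finset.mem_filter.2 ⟨hp₀s, hp₀b, rfl⟩)
    (mul_ne_zero (Finsupp.mem_support_iff.1 hp₀s)
      (one_div_ne_zero (Nat.cast_ne_zero.2 (Nat.factorial_ne_zero d))))
  let U : ℕ → ℂ := fun n => ∑ p ∈ T, c p * (1 / (d.factorial : ℂ)) * (p.1 / (b : ℂ)) ^ n
  let B : ℝ := ∑ p ∈ T, ‖c p * (1 / (d.factorial : ℂ))‖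
  have hB : 0 ≤ B := Finset.sum_nonneg fun _ _ => norm_nonneg _
  have hU : ∀ n, ‖U n‖ ≤ B := by
    intro n
    refine (norm_sum_le _ _).trans (Finset.sum_le_sum fun p hp => ?_)
    rw [norm_mul, norm_pow, hT p hp, one_pow, mul_one]
  have hlim : Tendsto (fun n : ℕ => (a n : ℂ) / ((n : ℂ) ^ d * (b : ℂ) ^ n) - U n) atTop
      (𝓝 0) := by
    have h1 : Tendsto (fun n : ℕ => ∑ p ∈ c.support, c p *
        (p.1 ^ n * n.choose p.2 / ((n : ℂ) ^ d * (b : ℂ) ^ n) -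
          if ‖p.1‖ = b ∧ p.2 = d then 1 / (d.factorial : ℂ) * (p.1 / b) ^ n else 0))
        atTop (𝓝 (∑ p ∈ c.support, c p * 0)) :=
      tendsto_finsetSum _ fun p hp => (tendsto_expPoly_term hb (hmax₁ p hp)
        fun h => hmax₀ p (Finset.mem_filter.2 ⟨hp, h⟩)).const_mul _
    simp only [mul_zero, Finset.sum_const_zero] at h1
    refine h1.congr' ?_
    filter_upwards [hac] with n hn
    rw [hn, Finsupp.sum, Finset.sum_div]
    simp only [U, T, Finset.sum_filter]
    rw [← Finset.sum_sub_distrib]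
    refine Finset.sum_congr rfl fun p _ => ?_
    split_ifs <;> ring
  have hev := (tendsto_zero_iff_norm_tendsto_zero.1 hlim).eventually_lt_const (half_pos hκ)
  obtain ⟨n₀, hn₀⟩ := eventually_atTop.1 (hev.and (eventually_ge_atTop 1))
  have hnorm : ∀ n, 1 ≤ n → ‖(a n : ℂ) / ((n : ℂ) ^ d * (b : ℂ) ^ n)‖ * ((n : ℝ) ^ d * b ^ n) =
      a n := by
    intro n hn
    have : 0 < (n : ℝ) ^ d * b ^ n := by positivity
    rw [norm_div, norm_mul, norm_pow, norm_pow, hbC, Complex.norm_natCast, Complex.norm_natCast,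
      div_mul_cancel₀ _ this.ne']
  refine ⟨b, d, hb, κ / 2, B + κ / 2, w, n₀, half_pos hκ, by positivity, fun n hn => ⟨?_, ?_⟩⟩
  · obtain ⟨h1, h2⟩ := hn₀ n hn
    rw [← hnorm n h2]
    refine mul_le_mul_of_nonneg_right ?_ (by positivity)
    have := norm_sub_norm_le ((a n : ℂ) / ((n : ℂ) ^ d * (b : ℂ) ^ n)) (U n)
    linarith [hU n]
  · obtain ⟨j, hj1, hj2, hj3⟩ := hw n
    obtain ⟨h1, h2⟩ := hn₀ j (hn.trans hj1)
    refine ⟨j, hj1, hj2, ?_⟩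
    rw [← hnorm j h2]
    refine mul_le_mul_of_nonneg_right ?_ (by positivity)
    have := norm_sub_norm_le (U j) ((a j : ℂ) / ((j : ℂ) ^ d * (b : ℂ) ^ j))
    rw [norm_sub_rev] at this
    change κ ≤ ‖U j‖ at hj3
    linarith

theorem polynomialOrExponentialGrowth_of_satisfiesConstCoeffODE {a : ℕ → ℕ}
    (h : SatisfiesConstCoeffODE (expSeries a)) : PolynomialOrExponentialGrowth a := by
  rcases growsLike_of_eventuallyExpPoly (eventuallyExpPoly_of_satisfiesConstCoeffODE h) with
    h | ⟨b, d, hb, hg⟩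
  · exact Or.inl h
  rcases lt_trichotomy b 1 with hb1 | rfl | hb1
  -- For `b < 1` the upper bound tends to zero, and a natural number below one is zero.
  · left
    obtain ⟨c, C, w, n₀, -, -, hg⟩ := hg
    have h1 := (tendsto_pow_const_mul_const_pow_of_lt_one d hb.le hb1).const_mul C
    rw [mul_zero] at h1
    filter_upwards [h1.eventually_lt_const one_pos, eventually_ge_atTop n₀] with n hn hn₀
    have h2 : (a n : ℝ) < 1 := (hg n hn₀).1.trans_lt hn
    exact Nat.lt_one_iff.1 (by exact_mod_cast h2)
  · exact Or.inr (Or.inl ⟨d, by simpa using hg⟩)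
  · exact Or.inr (Or.inr ⟨b, d, hb1, hg⟩)

end Growth

end ShOp

theorem mainTheorem6 (k : Type u) [Field k] [CharZero k] :
    (∀ P : ShOp.ShuffleOperad.{u, v} k,
      P.HasShuffleRegularFiniteGroebnerBasis → ShOp.Subfactorial P.dim →
        ShOp.SatisfiesConstCoeffODE (ShOp.expSeries P.dim) ∧
        ShOp.IsRationalSeries (ShOp.ordSeries P.dim) ∧
        ShOp.PolynomialOrExponentialGrowth P.dim) ∧
    (∀ P : ShOp.SymmetricOperad.{u, v} k,
      P.toShuffle.HasShuffleRegularFiniteGroebnerBasis → ShOp.Subfactorial P.dim →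
        ShOp.SatisfiesConstCoeffODE (ShOp.expSeries P.dim) ∧
        ShOp.IsRationalSeries (ShOp.ordSeries P.dim) ∧
        ShOp.PolynomialOrExponentialGrowth P.dim) ∧
    (∀ a : ℕ → ℕ, (∃ b : ℝ, ∀ n : ℕ, 1 ≤ n → (a n : ℝ) ≤ b ^ n) → ShOp.Subfactorial a) ∧
    (∀ a : ℕ → ℕ, ShOp.SatisfiesConstCoeffODE (ShOp.expSeries a) ↔
      ShOp.IsRationalSeries (ShOp.ordSeries a)) := by
  have key : ∀ P : ShOp.ShuffleOperad.{u, v} k,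
      P.HasShuffleRegularFiniteGroebnerBasis → ShOp.Subfactorial P.dim →
        ShOp.SatisfiesConstCoeffODE (ShOp.expSeries P.dim) ∧
        ShOp.IsRationalSeries (ShOp.ordSeries P.dim) ∧
        ShOp.PolynomialOrExponentialGrowth P.dim := fun P hP hsub =>
    have h := (ShOp.isDerivFinite_expSeries_dim hP hsub).satisfiesConstCoeffODE
    ⟨h, (ShOp.satisfiesConstCoeffODE_iff_isRationalSeries _).1 h,
      ShOp.polynomialOrExponentialGrowth_of_satisfiesConstCoeffODE h⟩
  exact ⟨key, fun P => key P.toShuffle, fun _ => ShOp.subfactorial_of_le_pow,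
    ShOp.satisfiesConstCoeffODE_iff_isRationalSeries⟩
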